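/- Let $p$ be a prime. For a finite group $G$ and a Sylow $p$-subgroup $T$ of $G$, let $\mathcal O_T(G)$ be the category whose objects are the subgroups of $T$ and whose morphisms $P\to Q$ are the $G$-equivariant maps $G/P\to G/Q$; each such map has the form $gP\mapsto gaQ$ for some $a\in G$. For an $\mathbb F_pG$-module $N$, let $F_N\colon\mathcal O_T(G)^{\mathrm{op}}\to\mathsf{Ab}$ be the functor with $F_N(1)=N$ and $F_N(P)=0$ for $P\neq 1$, where the endomorphism $g\mapsto ga$ of the object $1$ acts on $F_N(1)=N$ by $n\mapsto an$. For $i\ge 0$ set $$\Lambda^i(G;N)=\varprojlim\nolimits^{i}_{\mathcal O_T(G)}F_N ,$$ the value at $F_N$ of the $i$-th right derived functor of the inverse limit functor on functors $\mathcal O_T(G)^{\mathrm{op}}\to\mathsf{Ab}$. Let $\Gamma$ be a finite group with $p\mid|\Gamma|$, let $C_p$ be the cyclic group of order $p$, and let $\Gamma\wr C_p=\Gamma^p\rtimes C_p$ be the wreath product in which $C_p$ permutes the $p$ factors regularly. For an $\mathbb F_p\Gamma$-module $M$, let $\Gamma\wr C_p$ act on $M^p$ with $\Gamma^p$ acting coordinatewise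 and $C_p$ permuting the coordinates. Then for every $\mathbb F_p\Gamma$-module $M$, every $i\ge 1$, and all choices of the Sylow $p$-subgroups of $\Gamma\wr C_p$ and of $\Gamma$ used to define the two sides, there is an isomorphism of abelian groups $$\Lambda^i(\Gamma\wr C_p;M^p)\cong\Lambda^{i-1}(\Gamma;M).$$ -/

import Mathlib

open CategoryTheory CategoryTheory.Limits Opposite

universe u

instance presheafAb_isGrothendieckAbelian (C : Type u) [SmallCategory C] :
    IsGrothendieckAbelian.{u} (Cᵒᵖ ⥤ AddCommGrpCat.{u}) where
  ab5OfSize := ⟨fun _ _ _ => inferInstance⟩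

instance limAb_additive (C : Type u) [SmallCategory C] :
    (lim : (Cᵒᵖ ⥤ AddCommGrpCat.{u}) ⥤ AddCommGrpCat.{u}).Additive :=
  Functor.additive_of_preserves_binary_products _

/-- The `i`-th higher limit of `F : Cᵒᵖ ⥤ Ab`: the value at `F` of the `i`-th right derived functor
of the inverse limit functor `(Cᵒᵖ ⥤ Ab) ⥤ Ab`. -/
noncomputable def higherLimit {C : Type u} [SmallCategory C] (i : ℕ)
    (F : Cᵒᵖ ⥤ AddCommGrpCat.{u}) : AddCommGrpCat.{u} :=
  ((lim : (Cᵒᵖ ⥤ AddCommGrpCat.{u}) ⥤ AddCommGrpCat.{u}).rightDerived i).obj F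

/-- Objects of the orbit category `O_T(G)`: the subgroups of `G` that are contained in `T`. -/
@[ext]
structure OrbitCat {G : Type u} [Group G] (T : Subgroup G) : Type u where
  toSubgroup : Subgroup G
  le : toSubgroup ≤ T

namespace OrbitCat

/-- Morphisms `P ⟶ Q` in `O_T(G)` are the `G`-equivariant maps `G/P → G/Q`. -/
instance {G : Type u} [Group G] (T : Subgroup G) : SmallCategory (OrbitCat T) where
  Hom P Q := (G ⧸ P.toSubgroup) →[G] (G ⧸ Q.toSubgroup)
  id P := MulActionHom.id G
  comp f g := MulActionHom.comp g f

/-- A morphism `P ⟶ Q` as an equivariant map `G/P → G/Q`. -/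
def toMap {G : Type u} [Group G] {T : Subgroup G} {P Q : OrbitCat T} (φ : P ⟶ Q) :
    (G ⧸ P.toSubgroup) →[G] (G ⧸ Q.toSubgroup) := φ

/-- An element `a` of `G` with `φ (g P) = g a Q` for all `g`. It is unique up to
right multiplication by `Q`, hence unique if `Q = 1`. -/
noncomputable def rep {G : Type u} [Group G] {T : Subgroup G} {P Q : OrbitCat T} (φ : P ⟶ Q) : G :=
  (toMap φ ((1 : G) : G ⧸ P.toSubgroup)).out

theorem toMap_apply {G : Type u} [Group G] {T : Subgroup G} {P Q : OrbitCat T} (φ : P ⟶ Q)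
    (g : G) : toMap φ (g : G ⧸ P.toSubgroup) = ((g * rep φ : G) : G ⧸ Q.toSubgroup) := by
  have h : ((rep φ : G) : G ⧸ Q.toSubgroup) = toMap φ ((1 : G) : G ⧸ P.toSubgroup) :=
    QuotientGroup.out_eq' _
  have h2 := (toMap φ).map_smul g ((1 : G) : G ⧸ P.toSubgroup)
  rw [← h, MulAction.Quotient.smul_coe, MulAction.Quotient.smul_coe] at h2
  simpa using h2

theorem rep_inv_mul_mem {G : Type u} [Group G] {T : Subgroup G} {P Q : OrbitCat T} (φ : P ⟶ Q)
    (g : G) (hg : g ∈ P.toSubgroup) : (rep φ)⁻¹ * g * rep φ ∈ Q.toSubgroup := by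
  have h : ((g : G) : G ⧸ P.toSubgroup) = ((1 : G) : G ⧸ P.toSubgroup) :=
    QuotientGroup.eq.2 (by simpa using hg)
  have h2 := congrArg (toMap φ) h
  rw [toMap_apply, toMap_apply, eq_comm, QuotientGroup.eq] at h2
  simpa [mul_assoc] using h2

theorem eq_bot_of_hom {G : Type u} [Group G] {T : Subgroup G} {P Q : OrbitCat T} (φ : P ⟶ Q)
    (hQ : Q.toSubgroup = ⊥) : P.toSubgroup = ⊥ := by
  rw [Subgroup.eq_bot_iff_forall]
  intro g hg
  have h := rep_inv_mul_mem φ g hg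
  rw [hQ, Subgroup.mem_bot] at h
  have h2 : g = rep φ * ((rep φ)⁻¹ * g * rep φ) * (rep φ)⁻¹ := by group
  rw [h2, h]
  simp

theorem rep_eq {G : Type u} [Group G] {T : Subgroup G} {P Q : OrbitCat T} (φ : P ⟶ Q)
    (hQ : Q.toSubgroup = ⊥) (a : G)
    (h : toMap φ ((1 : G) : G ⧸ P.toSubgroup) = (a : G ⧸ Q.toSubgroup)) : rep φ = a := by
  rw [toMap_apply, QuotientGroup.eq, hQ, Subgroup.mem_bot, one_mul] at h
  exact inv_mul_eq_one.1 h

end OrbitCat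

open Classical in
/-- The group `F_M(P)`: it is `M` if `P = 1` and `0` otherwise. -/
noncomputable def atomicSubgroup {G : Type u} [Group G] (M : Type u) [AddCommGroup M]
    (P : Subgroup G) : AddSubgroup M :=
  if P = ⊥ then ⊤ else ⊥

theorem mem_atomicSubgroup {G : Type u} [Group G] {M : Type u} [AddCommGroup M]
    {P : Subgroup G} {m : M} : m ∈ atomicSubgroup M P ↔ (P ≠ ⊥ → m = 0) := by
  unfold atomicSubgroup
  split_ifs with h <;> simp [h]

/-- The functor `F_M : O_T(G)ᵒᵖ ⥤ Ab` that sends `1` to `M` and every other object to `0`. A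
morphism `φ` with `φ (g P) = g a Q` acts as `m ↦ a • m`. -/
noncomputable def atomicFunctor {G : Type u} [Group G] (T : Subgroup G) {k : Type*} [CommRing k]
    {M : Type u} [AddCommGroup M] [Module k M] (ρ : Representation k G M) :
    (OrbitCat T)ᵒᵖ ⥤ AddCommGrpCat.{u} where
  obj P := AddCommGrpCat.of (atomicSubgroup M P.unop.toSubgroup)
  map {Q P} φ := AddCommGrpCat.ofHom
    (((ρ (OrbitCat.rep φ.unop)).toAddMonoidHom.comp
        (atomicSubgroup M Q.unop.toSubgroup).subtype).codRestrict
      (atomicSubgroup M P.unop.toSubgroup) (fun m => by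
        rw [mem_atomicSubgroup]
        intro hP
        have hm := mem_atomicSubgroup.1 m.2 (fun hQ => hP (OrbitCat.eq_bot_of_hom φ.unop hQ))
        simp [hm]))
  map_id P := by
    ext m
    by_cases hP : P.unop.toSubgroup = ⊥
    · have h : OrbitCat.rep (𝟙 P.unop) = 1 := OrbitCat.rep_eq _ hP 1 rfl
      simp [h]
    · have hm := mem_atomicSubgroup.1 m.2 hP
      simp [hm]
  map_comp {R Q P} ψ φ := by
    ext m
    by_cases hR : R.unop.toSubgroup = ⊥
    · have h : OrbitCat.rep (φ.unop ≫ ψ.unop) =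
          OrbitCat.rep φ.unop * OrbitCat.rep ψ.unop := by
        refine OrbitCat.rep_eq _ hR _ ?_
        have h1 : OrbitCat.toMap (φ.unop ≫ ψ.unop) ((1 : G) : G ⧸ P.unop.toSubgroup) =
          OrbitCat.toMap ψ.unop (OrbitCat.toMap φ.unop ((1 : G) : G ⧸ P.unop.toSubgroup)) := rfl
        rw [h1, OrbitCat.toMap_apply, OrbitCat.toMap_apply, one_mul]
      simp [h]
    · have hm := mem_atomicSubgroup.1 m.2 hR
      simp [hm]

/-- `Λ^i(G; M)`, computed with the Sylow `p`-subgroup `T` of `G`: the `i`-th higher limit of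
`F_M` over the orbit category `O_T(G)`. -/
noncomputable def Lambda {p : ℕ} {G : Type u} [Group G] (T : Sylow p G) (i : ℕ)
    {k : Type*} [CommRing k] {M : Type u} [AddCommGroup M] [Module k M]
    (ρ : Representation k G M) : AddCommGrpCat.{u} :=
  higherLimit i (atomicFunctor (T : Subgroup G) ρ)

/-- The cyclic group of order `p`, written multiplicatively. -/
abbrev CyclicGroup (p : ℕ) : Type := Multiplicative (ZMod p)

/-- The module `M^p` over `Γ ≀ C_p`, with coordinates indexed by `C_p`: the base group `Γ^p` acts
coordinatewise and `C_p` permutes the coordinates by translation. -/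
def wreathRep {p : ℕ} {Γ : Type u} [Group Γ] {k : Type*} [CommRing k]
    {M : Type u} [AddCommGroup M] [Module k M] (ρ : Representation k Γ M) :
    Representation k (Γ ≀ᵣ CyclicGroup p) (CyclicGroup p → M) where
  toFun w :=
    { toFun := fun ξ x => ρ (w.left x) (ξ (w.right⁻¹ * x))
      map_add' := fun ξ η => by ext x; simp
      map_smul' := fun c ξ => by ext x; simp }
  map_one' := by ext ξ x; simp
  map_mul' w v := by ext ξ x; simp [mul_assoc]

/-!
By Sylow's theorem, `Λ^i` may be computed over the category of all orbits with `p`-group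
stabilizers. For a normal subgroup `K` of `G` consider the functor that sends `G/A` to `M^A` if
`A ∩ K = 1` and to `0` otherwise, so that `K = G` gives the atomic functor `F_M`. For the base group
`K` of `Γ ≀ C_p` and the module `M^p` it is the middle term of a short exact sequence

  `0 → F_{M^p} → X → R F_M → 0`,

where `R` is the right Kan extension along `Γ/P ↦ (Γ ≀ C_p)/(P × C_p)`. On the right, the vanishing
of `H¹` of a coinduced (nonabelian) module shows that the complements of the base group are
conjugate. Right Kan extensions along such functors between orbit categories are products over
double cosets; hence they are exact, preserve injectives and do not change higher limits, and it
remains to show that all higher limits of `X` vanish.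

Now `X` is itself the right Kan extension of the functor `F_M` of `Γ × Γ^(p-1)`, whose second factor
acts trivially and has order divisible by `p`. A transfer argument replaces the second factor by its
Sylow subgroup `Q`. As `1 × Q` is a nontrivial normal `p`-subgroup of `Γ × Q`, the higher limits may
be computed over the stabilizers that contain it, and there `F_M` is zero.
-/

section DerivedFunctors

variable {A B E : Type*} [Category* A] [Abelian A] [Category* B] [Abelian B] [Category* E]
  [Abelian E]

/-- The image of an injective resolution under an exact functor that preserves injectives. -/
noncomputable def mapInjectiveResolution (R : A ⥤ B) [R.Additive] [R.PreservesHomology]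
    [R.PreservesInjectiveObjects] {Z : A} (I : InjectiveResolution Z) :
    InjectiveResolution (R.obj Z) where
  cocomplex := (R.mapHomologicalComplex _).obj I.cocomplex
  injective n := Functor.PreservesInjectiveObjects.injective_obj (I.injective n)
  ι := (HomologicalComplex.singleMapHomologicalComplex _ _ _).inv.app _ ≫
    (R.mapHomologicalComplex _).map I.ι
  quasiIso := inferInstance

theorem rightDerived_obj_iso_comp [HasInjectiveResolutions A] [HasInjectiveResolutions B]
    (R : A ⥤ B) [R.Additive] [R.PreservesHomology] [R.PreservesInjectiveObjects]
    (L : B ⥤ E) [L.Additive] (n : ℕ) (Z : A) :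
    Nonempty ((L.rightDerived n).obj (R.obj Z) ≅ ((R ⋙ L).rightDerived n).obj Z) :=
  ⟨(mapInjectiveResolution R (injectiveResolution Z)).isoRightDerivedObj L n ≪≫
    ((injectiveResolution Z).isoRightDerivedObj (R ⋙ L) n).symm⟩

/-- Isomorphic functors have isomorphic right derived functors. -/
noncomputable def rightDerivedIso [HasInjectiveResolutions A] {F G : A ⥤ B} [F.Additive]
    [G.Additive] (e : F ≅ G) (n : ℕ) : F.rightDerived n ≅ G.rightDerived n where
  hom := NatTrans.rightDerived e.hom n
  inv := NatTrans.rightDerived e.inv n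
  hom_inv_id := by rw [← NatTrans.rightDerived_comp, e.hom_inv_id, NatTrans.rightDerived_id]
  inv_hom_id := by rw [← NatTrans.rightDerived_comp, e.inv_hom_id, NatTrans.rightDerived_id]

end DerivedFunctors

section Ext

universe v w

variable {A : Type w} [Category.{v} A] [Abelian A] [HasExt.{v} A]

theorem rightDerived_coyoneda_succ_addEquiv_ext [HasInjectiveResolutions A] (X Y : A) (n : ℕ) :
    Nonempty (((preadditiveCoyoneda.obj (op X)).rightDerived (n + 1)).obj Y ≃+
      Abelian.Ext.{v} X Y (n + 1)) := by
  let I := injectiveResolution Y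
  let F : A ⥤ AddCommGrpCat.{v} := preadditiveCoyoneda.obj (op X)
  let d₁ := I.cocomplex.d n (n + 1)
  let d₂ := I.cocomplex.d (n + 1) (n + 2)
  let S : ShortComplex AddCommGrpCat.{v} := ShortComplex.mk (F.map d₁) (F.map d₂)
    (by rw [← F.map_comp, I.cocomplex.d_comp_d, F.map_zero])
  let φ : S.g.hom.ker →+ Abelian.Ext.{v} X Y (n + 1) :=
    AddMonoidHom.mk' (fun z => I.extMk z.1 (n + 2) rfl z.2) (fun a b => (I.add_extMk ..).symm)
  have hφ : Function.Surjective φ := fun α => by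
    obtain ⟨f, hf, rfl⟩ := I.extMk_surjective α (n + 2) rfl
    exact ⟨⟨f, hf⟩, rfl⟩
  have boundaries_eq_ker : S.abToCycles.range = φ.ker := by
    ext z
    refine Iff.trans ?_ (I.extMk_eq_zero_iff z.1 (n + 2) rfl z.2 n rfl).symm
    exact exists_congr fun g => Subtype.ext_iff
  exact ⟨(I.isoRightDerivedObj F (n + 1) ≪≫ ShortComplex.homologyMapIso
      (((F.mapHomologicalComplex _).obj I.cocomplex).isoSc' n (n + 1) (n + 2) (by simp) (by simp))
      ≪≫ S.abHomologyIso).addCommGroupIsoToAddEquiv.trans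
    ((QuotientAddGroup.quotientAddEquivOfEq boundaries_eq_ker).trans
      (QuotientAddGroup.quotientKerEquivOfSurjective φ hφ))⟩

theorem rightDerived_coyoneda_addEquiv_ext [HasInjectiveResolutions A] (X Y : A) (n : ℕ) :
    Nonempty (((preadditiveCoyoneda.obj (op X)).rightDerived n).obj Y ≃+
      Abelian.Ext.{v} X Y n) := by
  cases n with
  | zero =>
    exact ⟨((preadditiveCoyoneda.obj (op X)).rightDerivedZeroIsoSelf.app
      Y).addCommGroupIsoToAddEquiv.trans Abelian.Ext.addEquiv₀.symm⟩
  | succ n => exact rightDerived_coyoneda_succ_addEquiv_ext X Y n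

theorem ext_addEquiv_ext_succ_of_shortExact (X : A) {S : ShortComplex A} (hS : S.ShortExact)
    (h : ∀ n, Subsingleton (Abelian.Ext.{v} X S.X₂ n)) (n : ℕ) :
    Nonempty (Abelian.Ext.{v} X S.X₃ n ≃+ Abelian.Ext.{v} X S.X₁ (n + 1)) := by
  let δ : Abelian.Ext.{v} X S.X₃ n →+ Abelian.Ext.{v} X S.X₁ (n + 1) :=
    hS.extClass.postcomp X rfl
  refine ⟨AddEquiv.ofBijective δ ⟨(injective_iff_map_eq_zero δ).2 fun x hx => ?_, fun x =>
    Abelian.Ext.covariant_sequence_exact₁ X hS x (Subsingleton.elim _ _) rfl⟩⟩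
  obtain ⟨y, rfl⟩ := Abelian.Ext.covariant_sequence_exact₃ X hS x rfl hx
  rw [Subsingleton.elim y 0, Abelian.Ext.zero_comp]

end Ext

section HigherLimits

variable {C D : Type u} [SmallCategory C] [SmallCategory D]

/-- Isomorphic functors have isomorphic higher limits. -/
noncomputable def higherLimitIso (i : ℕ) {F F' : Cᵒᵖ ⥤ AddCommGrpCat.{u}} (e : F ≅ F') :
    higherLimit i F ≅ higherLimit i F' :=
  (lim.rightDerived i).mapIso e

theorem isZero_higherLimit_of_isZero (i : ℕ) {F : Cᵒᵖ ⥤ AddCommGrpCat.{u}} (hF : IsZero F) :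
    IsZero (higherLimit i F) := by
  have := hF.injective
  cases i with
  | zero => exact (Functor.map_isZero lim hF).of_iso (lim.rightDerivedZeroIsoSelf.app F)
  | succ i => exact Functor.isZero_rightDerived_obj_injective_succ _ i F

theorem isZero_higherLimit_of_retract (i : ℕ) {F F' : Cᵒᵖ ⥤ AddCommGrpCat.{u}}
    (e : Retract F F') (hF' : IsZero (higherLimit i F')) : IsZero (higherLimit i F) := by
  let e' : Retract (higherLimit i F) (higherLimit i F') := e.map (lim.rightDerived i)
  exact IsZero.of_mono e'.i hF'

theorem higherLimit_iso_of_preservesInjectives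
    (R : (Dᵒᵖ ⥤ AddCommGrpCat.{u}) ⥤ (Cᵒᵖ ⥤ AddCommGrpCat.{u})) [R.Additive]
    [R.PreservesHomology] [R.PreservesInjectiveObjects] (e : R ⋙ lim ≅ lim)
    (i : ℕ) (F : Dᵒᵖ ⥤ AddCommGrpCat.{u}) :
    Nonempty (higherLimit i (R.obj F) ≅ higherLimit i F) :=
  (rightDerived_obj_iso_comp R lim i F).map (· ≪≫ (rightDerivedIso e i).app F)

theorem higherLimit_comp_iso_of_adjunction {L : C ⥤ D} {R : D ⥤ C} (adj : L ⊣ R) (i : ℕ)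
    (F : Cᵒᵖ ⥤ AddCommGrpCat.{u}) :
    Nonempty (higherLimit i (R.op ⋙ F) ≅ higherLimit i F) := by
  let res := (Functor.whiskeringLeft _ _ AddCommGrpCat.{u}).obj R.op
  have : R.IsRightAdjoint := adj.isRightAdjoint
  have : res.PreservesInjectiveObjects :=
    Functor.preservesInjectiveObjects_of_adjunction_of_preservesMonomorphisms
      (adj.op.whiskerLeft AddCommGrpCat.{u})
  have : res.Additive := {}
  exact higherLimit_iso_of_preservesInjectives res
    (Functor.Initial.limIso R.op) i F

variable (C) in
/-- The constant functor with value `ℤ`; it represents the limit functor. -/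
noncomputable abbrev constInt : Cᵒᵖ ⥤ AddCommGrpCat.{u} :=
  (Functor.const Cᵒᵖ).obj (AddCommGrpCat.of (ULift.{u} ℤ))

/-- Homomorphisms from `ℤ` to an abelian group are its elements. -/
noncomputable def coyonedaIntIso :
    preadditiveCoyoneda.obj (op (AddCommGrpCat.of (ULift.{u} ℤ))) ≅ 𝟭 AddCommGrpCat.{u} :=
  NatIso.ofComponents (fun N => (AddEquiv.mk' (ConcreteCategory.homEquiv.trans
    (uliftZMultiplesHom N.carrier).symm) fun _ _ => rfl).toAddCommGrpIso) fun _ => rfl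

variable (C) in
/-- The constant functor with value `ℤ` represents the limit functor. -/
noncomputable def coyonedaConstIntIso :
    preadditiveCoyoneda.obj (op (constInt C)) ≅ (lim : (Cᵒᵖ ⥤ AddCommGrpCat.{u}) ⥤ _) :=
  NatIso.ofComponents (fun F =>
      (constLimAdj.homAddEquiv (AddCommGrpCat.of (ULift.{u} ℤ)) F).toAddCommGrpIso)
    (fun f => by ext g; exact constLimAdj.homEquiv_naturality_right g f) ≪≫
  Functor.isoWhiskerLeft lim coyonedaIntIso ≪≫ Functor.rightUnitor lim

theorem higherLimit_addEquiv_ext (i : ℕ) (F : Cᵒᵖ ⥤ AddCommGrpCat.{u}) :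
    Nonempty (higherLimit i F ≃+ Abelian.Ext.{u} (constInt C) F i) :=
  (rightDerived_coyoneda_addEquiv_ext (constInt C) F i).map fun e =>
    ((rightDerivedIso (coyonedaConstIntIso C).symm i).app F).addCommGroupIsoToAddEquiv.trans e

theorem shortExact_of_app {S : ShortComplex (Cᵒᵖ ⥤ AddCommGrpCat.{u})}
    (hf : ∀ c, Function.Injective (S.f.app c)) (hg : ∀ c, Function.Surjective (S.g.app c))
    (h : ∀ c x, S.g.app c x = 0 → ∃ y, S.f.app c y = x) : S.ShortExact where
  exact := by
    rw [S.exact_iff_isZero_homology]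
    refine Functor.isZero _ fun c => IsZero.of_iso ?_
      (S.mapHomologyIso ((evaluation _ _).obj c)).symm
    rw [← ShortComplex.exact_iff_isZero_homology, ShortComplex.ab_exact_iff]
    exact h c
  mono_f := (NatTrans.mono_iff_mono_app _).2 fun c =>
    (AddCommGrpCat.mono_iff_injective _).2 (hf c)
  epi_g := (NatTrans.epi_iff_epi_app _).2 fun c =>
    (AddCommGrpCat.epi_iff_surjective _).2 (hg c)

theorem higherLimit_succ_iso_of_shortExact {S : ShortComplex (Cᵒᵖ ⥤ AddCommGrpCat.{u})}
    (hS : S.ShortExact) (h : ∀ i, IsZero (higherLimit i S.X₂)) (i : ℕ) :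
    Nonempty (higherLimit (i + 1) S.X₁ ≅ higherLimit i S.X₃) := by
  have ext_subsingleton (n : ℕ) : Subsingleton (Abelian.Ext.{u} (constInt C) S.X₂ n) := by
    have := AddCommGrpCat.subsingleton_of_isZero (h n)
    exact (higherLimit_addEquiv_ext n S.X₂).some.symm.subsingleton
  obtain ⟨e₁⟩ := higherLimit_addEquiv_ext (i + 1) S.X₁
  obtain ⟨e₃⟩ := higherLimit_addEquiv_ext i S.X₃
  obtain ⟨δ⟩ := ext_addEquiv_ext_succ_of_shortExact (constInt C) hS ext_subsingleton i
  exact ⟨(e₁.trans (δ.symm.trans e₃.symm)).toAddCommGrpIso⟩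

end HigherLimits

section RightKanExtension

variable {C D : Type u} [SmallCategory C] [SmallCategory D] (Φ : D ⥤ C)

section Evaluation

variable {Φ} {F F' : Dᵒᵖ ⥤ AddCommGrpCat.{u}} {c : C} {d : D}

/-- The component at `f : Φ d ⟶ c` of an element of the right Kan extension of `F` along `Φ`.
These components identify the value at `c` with the compatible families of elements of `F d`. -/
noncomputable def ranEval (f : Φ.obj d ⟶ c) :
    (Φ.op.ran.obj F).obj (op c) ⟶ F.obj (op d) :=
  (Φ.op.ran.obj F).map f.op ≫ (Φ.op.ranCounit.app F).app (op d)

theorem ranEval_map_comp {d' : D} (v : d' ⟶ d) (f : Φ.obj d ⟶ c)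
    (x : (Φ.op.ran.obj F).obj (op c)) :
    ranEval (Φ.map v ≫ f) x = F.map v.op (ranEval f x) := by
  have h : ranEval (F := F) (Φ.map v ≫ f) = ranEval f ≫ F.map v.op := by
    have := (Φ.op.ranCounit.app F).naturality v.op
    dsimp at this
    simp only [ranEval, op_comp, Functor.map_comp, Category.assoc]
    rw [this]
  rw [h, ConcreteCategory.comp_apply]

theorem ranEval_map {c' : C} (φ : c' ⟶ c) (f : Φ.obj d ⟶ c')
    (x : (Φ.op.ran.obj F).obj (op c)) :
    ranEval f ((Φ.op.ran.obj F).map φ.op x) = ranEval (f ≫ φ) x := by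
  simp [ranEval]

theorem ranEval_ran_map_app (α : F ⟶ F') (f : Φ.obj d ⟶ c) (x : (Φ.op.ran.obj F).obj (op c)) :
    ranEval f ((Φ.op.ran.map α).app (op c) x) = α.app (op d) (ranEval f x) := by
  have h : (Φ.op.ran.map α).app (op c) ≫ ranEval f = ranEval f ≫ α.app (op d) := by
    have := congr_app (Φ.op.ranCounit.naturality α) (op d)
    dsimp at this
    simp only [ranEval, ← NatTrans.naturality_assoc, Category.assoc]
    rw [← this]
  simpa only [ConcreteCategory.comp_apply] using congr($h x)

theorem ranEval_homEquiv_app {X : Cᵒᵖ ⥤ AddCommGrpCat.{u}} (α : Φ.op ⋙ X ⟶ F)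
    (f : Φ.obj d ⟶ c) (x : X.obj (op c)) :
    ranEval f (((Φ.op.ranAdjunction _).homEquiv X F α).app (op c) x) =
      α.app (op d) (X.map f.op x) := by
  have h : ((Φ.op.ranAdjunction _).homEquiv X F α).app (op c) ≫ ranEval f =
      X.map f.op ≫ α.app (op d) := by
    have := congr_app (((Φ.op.ranAdjunction _).homEquiv X F).symm_apply_apply α) (op d)
    rw [Adjunction.homEquiv_counit] at this
    rw [← this, ranEval, ← NatTrans.naturality_assoc, Functor.ranAdjunction_counit]
    rfl
  simpa only [ConcreteCategory.comp_apply] using congr($h x)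

theorem ran_ext {x y : (Φ.op.ran.obj F).obj (op c)}
    (h : ∀ (d : D) (f : Φ.obj d ⟶ c), ranEval f x = ranEval f y) : x = y :=
  Concrete.isLimit_ext _ (Functor.isPointwiseRightKanExtensionRanCounit Φ.op F (op c)) x y
    fun j => h j.right.unop j.hom.unop

theorem exists_ranEval_eq (s : ∀ d : D, (Φ.obj d ⟶ c) → F.obj (op d))
    (hs : ∀ (d d' : D) (v : d ⟶ d') (f : Φ.obj d' ⟶ c), s d (Φ.map v ≫ f) = F.map v.op (s d' f)) :
    ∃ x : (Φ.op.ran.obj F).obj (op c), ∀ (d : D) (f : Φ.obj d ⟶ c), ranEval f x = s d f := by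
  let G := StructuredArrow.proj (op c) Φ.op ⋙ F
  let t : (G ⋙ forget _).sections := ⟨fun j => s j.right.unop j.hom.unop, fun {j j'} w => by
    have hw : j'.hom.unop = Φ.map w.right.unop ≫ j.hom.unop :=
      congrArg Quiver.Hom.unop (StructuredArrow.w w).symm
    exact ((hs _ _ _ _).symm.trans (congrArg _ hw.symm))⟩
  let e := Types.isLimitEquivSections (isLimitOfPreserves (forget AddCommGrpCat.{u})
    (Functor.isPointwiseRightKanExtensionRanCounit Φ.op F (op c)))
  exact ⟨e.symm t, fun d f => congrFun (congrArg Subtype.val (e.apply_symm_apply t))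
    (StructuredArrow.mk (Y := op d) f.op)⟩

end Evaluation

instance : (Φ.op.ran : (Dᵒᵖ ⥤ AddCommGrpCat.{u}) ⥤ _).Additive :=
  (Φ.op.ranAdjunction AddCommGrpCat.{u}).right_adjoint_additive

instance : (Φ.op.ran : (Dᵒᵖ ⥤ AddCommGrpCat.{u}) ⥤ _).PreservesInjectiveObjects :=
  Functor.preservesInjectiveObjects_of_adjunction_of_preservesMonomorphisms
    (Φ.op.ranAdjunction AddCommGrpCat.{u})

variable {Φ}

theorem bijective_ranEval {c : C} {J : Type u} {t : J → D} {ε : ∀ j, Φ.obj (t j) ⟶ c}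
    (h : ∀ (d : D) (f : Φ.obj d ⟶ c), ∃! x : Σ j, d ⟶ t j, Φ.map x.2 ≫ ε x.1 = f)
    (F : Dᵒᵖ ⥤ AddCommGrpCat.{u}) :
    Function.Bijective fun (x : (Φ.op.ran.obj F).obj (op c)) j => ranEval (ε j) x := by
  choose fac hfac hfac_unique using h
  refine ⟨fun x y hxy => ran_ext fun d f => ?_, fun s => ?_⟩
  · rw [← hfac d f, ranEval_map_comp, ranEval_map_comp]
    exact congrArg _ (congrFun hxy _)
  · obtain ⟨x, hx⟩ := exists_ranEval_eq (fun d f => F.map (fac d f).2.op (s (fac d f).1))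
      fun d d' v f => by
        have fac_comp := hfac_unique d (Φ.map v ≫ f) ⟨(fac d' f).1, v ≫ (fac d' f).2⟩
          (by simp only [Functor.map_comp, Category.assoc, hfac])
        rw [← fac_comp]
        simp
    refine ⟨x, funext fun j => ?_⟩
    have fac_self := hfac_unique (t j) (ε j) ⟨j, 𝟙 (t j)⟩ (by simp)
    dsimp only
    rw [hx, ← fac_self]
    simp

/-- A functor `Φ` has a multi right adjoint if every morphism `Φ d ⟶ c` factors uniquely through
exactly one of a family of morphisms `Φ (t j) ⟶ c`. -/
def IsMultiLeftAdjoint (Φ : D ⥤ C) : Prop :=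
  ∀ c : C, ∃ (J : Type u) (t : J → D) (ε : ∀ j, Φ.obj (t j) ⟶ c),
    ∀ (d : D) (f : Φ.obj d ⟶ c), ∃! x : Σ j, d ⟶ t j, Φ.map x.2 ≫ ε x.1 = f

namespace IsMultiLeftAdjoint

theorem ran_preservesEpimorphisms (hΦ : IsMultiLeftAdjoint Φ) :
    (Φ.op.ran : (Dᵒᵖ ⥤ AddCommGrpCat.{u}) ⥤ _).PreservesEpimorphisms where
  preserves {F F'} α hα := by
    simp only [NatTrans.epi_iff_epi_app, AddCommGrpCat.epi_iff_surjective] at hα ⊢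
    rintro ⟨c⟩ y
    obtain ⟨J, t, ε, h⟩ := hΦ c
    choose s hs using fun j => hα (op (t j)) (ranEval (ε j) y)
    obtain ⟨x, rfl⟩ := (bijective_ranEval h F).2 s
    refine ⟨x, (bijective_ranEval h F').1 (funext fun j => ?_)⟩
    dsimp only
    rw [ranEval_ran_map_app, hs]

theorem ran_preservesHomology (hΦ : IsMultiLeftAdjoint Φ) :
    (Φ.op.ran : (Dᵒᵖ ⥤ AddCommGrpCat.{u}) ⥤ _).PreservesHomology := by
  have := hΦ.ran_preservesEpimorphisms
  have : PreservesLimits (Φ.op.ran : (Dᵒᵖ ⥤ AddCommGrpCat.{u}) ⥤ _) :=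
    (Φ.op.ranAdjunction _).rightAdjoint_preservesLimits
  exact Functor.preservesHomology_of_preservesEpis_and_kernels _

theorem higherLimit_ran_iso (hΦ : IsMultiLeftAdjoint Φ) (i : ℕ) (F : Dᵒᵖ ⥤ AddCommGrpCat.{u}) :
    Nonempty (higherLimit i (Φ.op.ran.obj F) ≅ higherLimit i F) :=
  have := hΦ.ran_preservesHomology
  higherLimit_iso_of_preservesInjectives Φ.op.ran Φ.op.ranCompLimIso i F

end IsMultiLeftAdjoint

end RightKanExtension

open scoped Pointwise

section OrbitCategory

variable {G : Type u} [Group G]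

theorem mem_conj_smul_iff {A : Subgroup G} {a x : G} :
    x ∈ MulAut.conj a • A ↔ a⁻¹ * x * a ∈ A := by
  rw [Subgroup.mem_pointwise_smul_iff_inv_smul_mem, ← map_inv, MulAut.smul_def,
    MulAut.conj_apply, inv_inv]

theorem le_conj_smul_mul {P Q R : Subgroup G} {a b : G} (h₁ : P ≤ MulAut.conj a • Q)
    (h₂ : Q ≤ MulAut.conj b • R) : P ≤ MulAut.conj (a * b) • R := by
  rw [map_mul, mul_smul]
  exact h₁.trans (Subgroup.pointwise_smul_le_pointwise_smul_iff.2 h₂)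

theorem conj_smul_eq_of_mk_eq {Q : Subgroup G} {a b : G} (h : (a : G ⧸ Q) = b) :
    MulAut.conj a • Q = MulAut.conj b • Q := by
  rw [← mul_inv_cancel_left a b, map_mul, mul_smul,
    Subgroup.conj_smul_eq_self_of_mem (QuotientGroup.eq.1 h)]

namespace OrbitCat

variable {T : Subgroup G} {P Q R : OrbitCat T}

theorem hom_ext {φ ψ : P ⟶ Q} (h : ((rep φ : G) : G ⧸ Q.toSubgroup) = (rep ψ : G)) : φ = ψ :=
  MulActionHom.ext fun x => by
    obtain ⟨g, rfl⟩ := QuotientGroup.mk_surjective x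
    refine (toMap_apply φ g).trans (Eq.trans ?_ (toMap_apply ψ g).symm)
    exact congrArg (g • ·) h

theorem le_conj_smul_rep (φ : P ⟶ Q) : P.toSubgroup ≤ MulAut.conj (rep φ) • Q.toSubgroup :=
  fun x hx => mem_conj_smul_iff.2 (rep_inv_mul_mem φ x hx)

/-- The morphism `g P ↦ g a Q`. -/
def homMk (a : G) (h : P.toSubgroup ≤ MulAut.conj a • Q.toSubgroup) : P ⟶ Q :=
  show (G ⧸ P.toSubgroup) →[G] (G ⧸ Q.toSubgroup) from
  { toFun := fun x => Quotient.liftOn' x (fun g => ((g * a : G) : G ⧸ Q.toSubgroup))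
      (fun g g' hg => by
        rw [QuotientGroup.leftRel_apply] at hg
        rw [QuotientGroup.eq]
        simpa only [mul_inv_rev, mul_assoc] using mem_conj_smul_iff.1 (h hg))
    map_smul' := fun g x => by
      obtain ⟨y, rfl⟩ := QuotientGroup.mk_surjective x
      exact congrArg QuotientGroup.mk (mul_assoc g y a) }

theorem mk_rep_homMk (a : G) (h : P.toSubgroup ≤ MulAut.conj a • Q.toSubgroup) :
    ((rep (homMk a h) : G) : G ⧸ Q.toSubgroup) = a :=
  (QuotientGroup.out_eq' _).trans (congrArg QuotientGroup.mk (one_mul a))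

theorem mk_rep_id (P : OrbitCat T) : ((rep (𝟙 P) : G) : G ⧸ P.toSubgroup) = (1 : G) :=
  QuotientGroup.out_eq' _

theorem mk_rep_comp (φ : P ⟶ Q) (ψ : Q ⟶ R) :
    ((rep (φ ≫ ψ) : G) : G ⧸ R.toSubgroup) = (rep φ * rep ψ : G) := by
  refine (QuotientGroup.out_eq' _).trans ?_
  change toMap ψ (toMap φ ((1 : G) : G ⧸ P.toSubgroup)) = _
  rw [toMap_apply, toMap_apply, one_mul]

theorem homMk_eq_homMk_iff {a b : G} {ha : P.toSubgroup ≤ MulAut.conj a • Q.toSubgroup}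
    {hb : P.toSubgroup ≤ MulAut.conj b • Q.toSubgroup} :
    homMk a ha = homMk b hb ↔ (a : G ⧸ Q.toSubgroup) = b :=
  ⟨fun h => by rw [← mk_rep_homMk a ha, h, mk_rep_homMk], fun h => hom_ext (by
    rw [mk_rep_homMk, mk_rep_homMk, h])⟩

theorem homMk_rep (φ : P ⟶ Q) : homMk (rep φ) (le_conj_smul_rep φ) = φ :=
  hom_ext (mk_rep_homMk _ _)

theorem homMk_comp_homMk {a b : G} (ha : P.toSubgroup ≤ MulAut.conj a • Q.toSubgroup)
    (hb : Q.toSubgroup ≤ MulAut.conj b • R.toSubgroup) :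
    homMk a ha ≫ homMk b hb = homMk (a * b) (le_conj_smul_mul ha hb) :=
  MulActionHom.ext fun x => by
    obtain ⟨g, rfl⟩ := QuotientGroup.mk_surjective x
    exact congrArg QuotientGroup.mk (mul_assoc g a b)

end OrbitCat
end OrbitCategory

section OrbitFamily

variable {G : Type u} [Group G]

/-- The orbit category of `G` on a set `𝓕` of subgroups: the full subcategory of the category of
transitive `G`-sets on the objects `G/P` with `P ∈ 𝓕`. -/
abbrev OrbitFamily (𝓕 : Set (Subgroup G)) : Type u :=
  ObjectProperty.FullSubcategory fun P : OrbitCat (⊤ : Subgroup G) => P.toSubgroup ∈ 𝓕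

namespace OrbitFamily

variable {𝓕 : Set (Subgroup G)}

/-- The object `G/P`. -/
abbrev mk (P : Subgroup G) (hP : P ∈ 𝓕) : OrbitFamily 𝓕 := ⟨⟨P, le_top⟩, hP⟩

/-- The subgroup `P` of the object `G/P`. -/
abbrev sub (P : OrbitFamily 𝓕) : Subgroup G := P.obj.toSubgroup

variable {P Q R : OrbitFamily 𝓕}

/-- The morphism `g P ↦ g a Q`. -/
def homMk (a : G) (h : P.sub ≤ MulAut.conj a • Q.sub) : P ⟶ Q :=
  ObjectProperty.homMk (OrbitCat.homMk a h)

/-- An element `a` such that the morphism is `g P ↦ g a Q`. -/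
noncomputable def rep (φ : P ⟶ Q) : G := OrbitCat.rep φ.hom

theorem le_conj_smul_rep (φ : P ⟶ Q) : P.sub ≤ MulAut.conj (rep φ) • Q.sub :=
  OrbitCat.le_conj_smul_rep φ.hom

theorem homMk_rep (φ : P ⟶ Q) : homMk (rep φ) (le_conj_smul_rep φ) = φ :=
  ObjectProperty.hom_ext _ (OrbitCat.homMk_rep φ.hom)

theorem mk_rep_homMk (a : G) (h : P.sub ≤ MulAut.conj a • Q.sub) :
    ((rep (homMk a h) : G) : G ⧸ Q.sub) = a :=
  OrbitCat.mk_rep_homMk a h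

theorem mk_rep_id (P : OrbitFamily 𝓕) : ((rep (𝟙 P) : G) : G ⧸ P.sub) = (1 : G) :=
  OrbitCat.mk_rep_id P.obj

theorem mk_rep_comp (φ : P ⟶ Q) (ψ : Q ⟶ R) :
    ((rep (φ ≫ ψ) : G) : G ⧸ R.sub) = (rep φ * rep ψ : G) :=
  OrbitCat.mk_rep_comp φ.hom ψ.hom

theorem homMk_eq_homMk_iff {a b : G} {ha : P.sub ≤ MulAut.conj a • Q.sub}
    {hb : P.sub ≤ MulAut.conj b • Q.sub} :
    homMk a ha = homMk b hb ↔ (a : G ⧸ Q.sub) = b :=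
  InducedCategory.hom_ext_iff.trans (OrbitCat.homMk_eq_homMk_iff (ha := ha) (hb := hb))

theorem homMk_comp_homMk {a b : G} (ha : P.sub ≤ MulAut.conj a • Q.sub)
    (hb : Q.sub ≤ MulAut.conj b • R.sub) :
    homMk a ha ≫ homMk b hb = homMk (a * b) (le_conj_smul_mul ha hb) :=
  ObjectProperty.hom_ext _ (OrbitCat.homMk_comp_homMk ha hb)

/-- The isomorphism `x aQa⁻¹ ↦ x a Q` between the orbits of conjugate subgroups. -/
def isoOfConjEq (a : G) (h : P.sub = MulAut.conj a • Q.sub) : P ≅ Q where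
  hom := homMk a h.le
  inv := homMk a⁻¹ (by rw [h, map_inv, inv_smul_smul])
  hom_inv_id := by
    rw [homMk_comp_homMk, ← homMk_rep (𝟙 P), homMk_eq_homMk_iff, mk_rep_id, mul_inv_cancel]
  inv_hom_id := by
    rw [homMk_comp_homMk, ← homMk_rep (𝟙 Q), homMk_eq_homMk_iff, mk_rep_id, inv_mul_cancel]

end OrbitFamily

end OrbitFamily

section InvariantsAvoiding

variable {G : Type u} [Group G] (K : Subgroup G) {k : Type*} [CommRing k] {M : Type u}
  [AddCommGroup M] [Module k M] (ρ : Representation k G M)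

/-- The invariants of `A` on `M` if `A` meets `K` trivially, and `0` otherwise. -/
def invariantsAvoidingSubgroup (A : Subgroup G) : AddSubgroup M where
  carrier := {m | (∀ a ∈ A, ρ a m = m) ∧ (¬ Disjoint A K → m = 0)}
  zero_mem' := ⟨fun _ _ => map_zero _, fun _ => rfl⟩
  add_mem' := fun {m n} hm hn => ⟨fun a ha => by rw [map_add, hm.1 a ha, hn.1 a ha],
    fun h => by rw [hm.2 h, hn.2 h, add_zero]⟩
  neg_mem' := fun {m} hm => ⟨fun a ha => by rw [map_neg, hm.1 a ha],
    fun h => by rw [hm.2 h, neg_zero]⟩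

variable {K ρ}

theorem mem_invariantsAvoidingSubgroup {A : Subgroup G} {m : M} :
    m ∈ invariantsAvoidingSubgroup K ρ A ↔
      (∀ a ∈ A, ρ a m = m) ∧ (¬ Disjoint A K → m = 0) :=
  Iff.rfl

theorem disjoint_of_le_conj_smul [K.Normal] {A B : Subgroup G} {a : G}
    (h : A ≤ MulAut.conj a • B) (hB : Disjoint B K) : Disjoint A K := by
  rw [← Subgroup.Normal.conj_smul_eq_self a K]
  refine Disjoint.mono_left h ?_
  rw [disjoint_iff] at hB ⊢
  rw [← Subgroup.smul_inf, hB, Subgroup.smul_bot]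

theorem disjoint_conj_smul_iff [K.Normal] {A : Subgroup G} {a : G} :
    Disjoint (MulAut.conj a • A) K ↔ Disjoint A K :=
  ⟨disjoint_of_le_conj_smul (a := a⁻¹) (by
    rw [← mul_smul, ← map_mul, inv_mul_cancel, map_one, one_smul]),
    disjoint_of_le_conj_smul le_rfl⟩

theorem apply_mem_invariantsAvoidingSubgroup [K.Normal] {A B : Subgroup G} {a : G}
    (h : A ≤ MulAut.conj a • B) {m : M} (hm : m ∈ invariantsAvoidingSubgroup K ρ B) :
    ρ a m ∈ invariantsAvoidingSubgroup K ρ A := by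
  refine ⟨fun x hx => ?_, fun hA => ?_⟩
  · conv_rhs => rw [← hm.1 _ (mem_conj_smul_iff.1 (h hx))]
    simp only [← Module.End.mul_apply, ← map_mul, mul_assoc, mul_inv_cancel_left]
  · rw [hm.2 fun hB => hA (disjoint_of_le_conj_smul h hB), map_zero]

theorem apply_eq_apply_of_mk_eq {B : Subgroup G} {a b : G} (h : (a : G ⧸ B) = b) {m : M}
    (hm : m ∈ invariantsAvoidingSubgroup K ρ B) : ρ a m = ρ b m := by
  conv_lhs => rw [← hm.1 _ (QuotientGroup.eq.1 h)]
  simp only [← Module.End.mul_apply, ← map_mul, mul_inv_cancel_left]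

theorem invariantsAvoidingSubgroup_mono {L A : Subgroup G} (h : K ≤ L) :
    invariantsAvoidingSubgroup L ρ A ≤ invariantsAvoidingSubgroup K ρ A := fun _ hm =>
  ⟨hm.1, fun hA => hm.2 fun hA' => hA (hA'.mono_right h)⟩

variable (K ρ)

/-- The functor `G/A ↦ M^A` for `A` meeting `K` trivially, extended by zero to all other orbits.
For `K = ⊤` it is the atomic functor of `M`. -/
noncomputable def invariantsAvoiding [K.Normal] (𝓕 : Set (Subgroup G)) :
    (OrbitFamily 𝓕)ᵒᵖ ⥤ AddCommGrpCat.{u} where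
  obj A := AddCommGrpCat.of (invariantsAvoidingSubgroup K ρ A.unop.sub)
  map {B A} φ := AddCommGrpCat.ofHom
    (((ρ (OrbitFamily.rep φ.unop)).toAddMonoidHom.comp (AddSubgroup.subtype _)).codRestrict _
      fun m => apply_mem_invariantsAvoidingSubgroup (OrbitFamily.le_conj_smul_rep φ.unop) m.2)
  map_id A := by
    ext m
    exact (apply_eq_apply_of_mk_eq (OrbitFamily.mk_rep_id A.unop) m.2).trans (by
      rw [map_one]
      rfl)
  map_comp φ ψ := by
    ext m
    exact (apply_eq_apply_of_mk_eq (OrbitFamily.mk_rep_comp ψ.unop φ.unop) m.2).trans (by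
      rw [map_mul]
      rfl)

variable {K ρ} [K.Normal] {𝓕 : Set (Subgroup G)} {A B : OrbitFamily 𝓕}

theorem invariantsAvoiding_map_homMk (a : G) (h : A.sub ≤ MulAut.conj a • B.sub)
    (m : (invariantsAvoiding K ρ 𝓕).obj (op B)) :
    (((invariantsAvoiding K ρ 𝓕).map (OrbitFamily.homMk a h).op m).1 : M) = ρ a m.1 :=
  apply_eq_apply_of_mk_eq (OrbitFamily.mk_rep_homMk a h) m.2

/-- The inclusion of functors given by an inclusion of the subgroups to be avoided. -/
noncomputable def invariantsAvoidingInclusion {L : Subgroup G} [L.Normal] (h : K ≤ L)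
    (ρ : Representation k G M) (𝓕 : Set (Subgroup G)) :
    invariantsAvoiding L ρ 𝓕 ⟶ invariantsAvoiding K ρ 𝓕 where
  app _ := AddCommGrpCat.ofHom (AddSubgroup.inclusion (invariantsAvoidingSubgroup_mono h))
  naturality _ _ _ := rfl

end InvariantsAvoiding

section Subfamily

variable {G : Type u} [Group G] {𝓐 𝓕 : Set (Subgroup G)}

/-- The functor of orbit categories given by an inclusion of sets of subgroups. -/
abbrev OrbitFamily.inclusion (h : 𝓐 ⊆ 𝓕) : OrbitFamily 𝓐 ⥤ OrbitFamily 𝓕 :=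
  ObjectProperty.ιOfLE fun P hP => h (a := P.toSubgroup) hP

/-- `r P` is the smallest overgroup of `P` in `𝓐`, and remains so among the conjugates of
members of `𝓐`. -/
structure IsReflectiveSubfamily (𝓐 𝓕 : Set (Subgroup G)) (r : Subgroup G → Subgroup G) :
    Prop where
  subset : 𝓐 ⊆ 𝓕
  mem : ∀ P ∈ 𝓕, r P ∈ 𝓐
  le : ∀ P ∈ 𝓕, P ≤ r P
  le_conj_smul : ∀ P ∈ 𝓕, ∀ A ∈ 𝓐, ∀ g : G, P ≤ MulAut.conj g • A → r P ≤ MulAut.conj g • A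

namespace IsReflectiveSubfamily

variable {r : Subgroup G → Subgroup G} (hr : IsReflectiveSubfamily 𝓐 𝓕 r)
include hr

/-- The unit `G/P ⟶ G/(r P)`. -/
def unit (P : OrbitFamily 𝓕) :
    P ⟶ (OrbitFamily.inclusion hr.subset).obj (.mk (r P.sub) (hr.mem _ P.property)) :=
  OrbitFamily.homMk 1 (by
    rw [map_one, one_smul]
    exact hr.le _ P.property)

theorem bijective_unit_comp (P : OrbitFamily 𝓕) (A : OrbitFamily 𝓐) :
    Function.Bijective fun φ : OrbitFamily.mk (r P.sub) (hr.mem _ P.property) ⟶ A =>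
      hr.unit P ≫ (OrbitFamily.inclusion hr.subset).map φ := by
  have unit_comp : ∀ a h, hr.unit P ≫ (OrbitFamily.inclusion hr.subset).map
      (OrbitFamily.homMk a h : OrbitFamily.mk (r P.sub) _ ⟶ A) =
      OrbitFamily.homMk a ((hr.le _ P.property).trans h) := fun a h => by
    refine (OrbitFamily.homMk_comp_homMk (Q := (OrbitFamily.inclusion hr.subset).obj _)
      (R := (OrbitFamily.inclusion hr.subset).obj A) _ h).trans ?_
    simp only [one_mul]
  refine ⟨fun φ ψ h => ?_, fun φ => ?_⟩
  · rw [← OrbitFamily.homMk_rep φ, ← OrbitFamily.homMk_rep ψ] at h ⊢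
    simp only [unit_comp, OrbitFamily.homMk_eq_homMk_iff] at h
    exact OrbitFamily.homMk_eq_homMk_iff.2 h
  · rw [← OrbitFamily.homMk_rep φ]
    exact ⟨OrbitFamily.homMk (OrbitFamily.rep φ) (hr.le_conj_smul _ P.property _ A.property _
      (OrbitFamily.le_conj_smul_rep φ)), unit_comp _ _⟩

theorem higherLimit_inclusion_iso (i : ℕ) (F : (OrbitFamily 𝓕)ᵒᵖ ⥤ AddCommGrpCat.{u}) :
    Nonempty (higherLimit i ((OrbitFamily.inclusion hr.subset).op ⋙ F) ≅ higherLimit i F) :=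
  higherLimit_comp_iso_of_adjunction (Adjunction.adjunctionOfEquivLeft
    (fun P A => Equiv.ofBijective _ (hr.bijective_unit_comp P A))
    fun P A B g φ => by
      simp only [Equiv.ofBijective_apply, Functor.map_comp, Category.assoc]) i F

end IsReflectiveSubfamily

/-- The `p`-subgroups of `G`. -/
def pSubgroups (p : ℕ) (G : Type u) [Group G] : Set (Subgroup G) := {P | IsPGroup p P}

theorem isReflectiveSubfamily_sup_normal {p : ℕ} {V : Subgroup G} [V.Normal]
    (hV : IsPGroup p V) :
    IsReflectiveSubfamily {A | A ∈ pSubgroups p G ∧ V ≤ A} (pSubgroups p G) (· ⊔ V) where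
  subset := fun _ h => h.1
  mem := fun _ hP => ⟨IsPGroup.to_sup_of_normal_right hP hV, le_sup_right⟩
  le := fun _ _ => le_sup_left
  le_conj_smul := fun _ _ _ hA g h => sup_le h (by
    rw [← Subgroup.Normal.conj_smul_eq_self g V]
    exact Subgroup.pointwise_smul_le_pointwise_smul_iff.2 hA.2)

section InvariantsAvoiding

variable {k : Type*} [CommRing k] {M : Type u} [AddCommGroup M] [Module k M]

theorem isZero_higherLimit_invariantsAvoiding_of_normal {p : ℕ} {V K : Subgroup G}
    [V.Normal] [K.Normal] (hV : IsPGroup p V) (hVK : ¬ Disjoint V K) (ρ : Representation k G M)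
    (i : ℕ) : IsZero (higherLimit i (invariantsAvoiding K ρ (pSubgroups p G))) := by
  obtain ⟨e⟩ := (isReflectiveSubfamily_sup_normal hV).higherLimit_inclusion_iso i
    (invariantsAvoiding K ρ (pSubgroups p G))
  refine (isZero_higherLimit_of_isZero i ?_).of_iso e.symm
  refine Functor.isZero _ fun A => ?_
  have hA : ¬ Disjoint A.unop.sub K := fun h => hVK (h.mono_left A.unop.property.2)
  exact @AddCommGrpCat.isZero_of_subsingleton _
    ⟨fun m n => Subtype.ext ((m.2.2 hA).trans (n.2.2 hA).symm)⟩

end InvariantsAvoiding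

end Subfamily

section OrbitInduction

variable {H W : Type u} [Group H] [Group W]

/-- The conditions under which `H/P ↦ W/(j(P) V)` is a functor from the orbits of `H` with
stabilizers in `𝓗` to the orbits of `W` with stabilizers in `𝓐` that has a multi right adjoint. -/
structure IsOrbitInduction (j : H →* W) (V : Subgroup W) (𝓗 : Set (Subgroup H))
    (𝓐 : Set (Subgroup W)) : Prop where
  bot_mem : ⊥ ∈ 𝓗
  map_sup_mem : ∀ P ∈ 𝓗, P.map j ⊔ V ∈ 𝓐
  comap_mem : ∀ A ∈ 𝓐, ∀ g : W, V ≤ MulAut.conj g • A → (MulAut.conj g • A).comap j ∈ 𝓗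
  le_conj_smul : ∀ h : H, V ≤ MulAut.conj (j h) • V

namespace IsOrbitInduction

variable {j : H →* W} {V : Subgroup W} {𝓗 : Set (Subgroup H)} {𝓐 : Set (Subgroup W)}

theorem mk_map_eq {Q : Subgroup H} {a b : H} (h : (a : H ⧸ Q) = b) :
    (j a : W ⧸ Q.map j ⊔ V) = j b := by
  rw [QuotientGroup.eq, ← map_inv, ← map_mul]
  exact le_sup_left (a := Q.map j) (Subgroup.mem_map_of_mem j (QuotientGroup.eq.1 h))

theorem le_conj_smul_comap {P : Subgroup H} {A : Subgroup W} {h : H} {g : W}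
    (hP : P.map j ≤ MulAut.conj (j h * g) • A) :
    P ≤ MulAut.conj h • (MulAut.conj g • A).comap j := fun x hx => by
  rw [mem_conj_smul_iff, Subgroup.mem_comap, mem_conj_smul_iff]
  simpa [mul_assoc] using mem_conj_smul_iff.1 (hP (Subgroup.mem_map_of_mem j hx))

theorem mk_eq_mk_comap_conj_smul {A : Subgroup W} {h h' : H} {g : W}
    (hh : ((j h * g : W) : W ⧸ A) = (j h' * g : W)) :
    (h : H ⧸ (MulAut.conj g • A).comap j) = h' := by
  rw [QuotientGroup.eq] at hh ⊢
  rw [Subgroup.mem_comap, mem_conj_smul_iff]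
  simpa [mul_assoc] using hh

variable (hj : IsOrbitInduction j V 𝓗 𝓐)
include hj

theorem map_sup_le_conj_smul {P Q : Subgroup H} {a : H} (h : P ≤ MulAut.conj a • Q) :
    P.map j ⊔ V ≤ MulAut.conj (j a) • (Q.map j ⊔ V) := by
  rw [Subgroup.smul_sup]
  refine sup_le_sup (Subgroup.map_le_iff_le_comap.2 fun x hx => ?_) (hj.le_conj_smul a)
  obtain ⟨y, hy, rfl⟩ := h hx
  exact ⟨j y, Subgroup.mem_map_of_mem j hy, by simp⟩

/-- The functor `H/P ↦ W/(j(P) V)`. -/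
noncomputable def functor : OrbitFamily 𝓗 ⥤ OrbitFamily 𝓐 where
  obj P := .mk (P.sub.map j ⊔ V) (hj.map_sup_mem _ P.property)
  map φ := OrbitFamily.homMk (j (OrbitFamily.rep φ))
    (hj.map_sup_le_conj_smul (OrbitFamily.le_conj_smul_rep φ))
  map_id P := by
    rw [← OrbitFamily.homMk_rep (𝟙 (OrbitFamily.mk (P.sub.map j ⊔ V) _)),
      OrbitFamily.homMk_eq_homMk_iff, OrbitFamily.mk_rep_id,
      mk_map_eq (OrbitFamily.mk_rep_id P), map_one]
  map_comp φ ψ := by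
    rw [OrbitFamily.homMk_comp_homMk, OrbitFamily.homMk_eq_homMk_iff, ← map_mul]
    exact mk_map_eq (OrbitFamily.mk_rep_comp φ ψ)

theorem functor_map_homMk {P Q : OrbitFamily 𝓗} (a : H) (h : P.sub ≤ MulAut.conj a • Q.sub) :
    hj.functor.map (OrbitFamily.homMk a h) =
      OrbitFamily.homMk (j a) (hj.map_sup_le_conj_smul h) :=
  OrbitFamily.homMk_eq_homMk_iff.2 (mk_map_eq (OrbitFamily.mk_rep_homMk a h))

variable {P : OrbitFamily 𝓗} {A : OrbitFamily 𝓐} {g : W}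

/-- The morphism `w j(P) V ↦ w g A`. -/
noncomputable def homMk (P : OrbitFamily 𝓗) (A : OrbitFamily 𝓐) (g : W)
    (hg : P.sub.map j ⊔ V ≤ MulAut.conj g • A.sub) : hj.functor.obj P ⟶ A :=
  OrbitFamily.homMk g hg

theorem exists_homMk_eq (f : hj.functor.obj P ⟶ A) : ∃ g hg, hj.homMk P A g hg = f :=
  ⟨_, _, OrbitFamily.homMk_rep f⟩

theorem homMk_eq_homMk_iff {g' : W} {hg : P.sub.map j ⊔ V ≤ MulAut.conj g • A.sub}
    {hg' : P.sub.map j ⊔ V ≤ MulAut.conj g' • A.sub} :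
    hj.homMk P A g hg = hj.homMk P A g' hg' ↔ (g : W ⧸ A.sub) = g' :=
  OrbitFamily.homMk_eq_homMk_iff

theorem homMk_comp_homMk {B : OrbitFamily 𝓐} {a : W}
    (hg : P.sub.map j ⊔ V ≤ MulAut.conj g • A.sub) (ha : A.sub ≤ MulAut.conj a • B.sub) :
    hj.homMk P A g hg ≫ OrbitFamily.homMk a ha =
      hj.homMk P B (g * a) (le_conj_smul_mul hg ha) :=
  OrbitFamily.homMk_comp_homMk _ ha

theorem functor_map_homMk_comp_homMk {Q : OrbitFamily 𝓗} {a : H}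
    (h : P.sub ≤ MulAut.conj a • Q.sub) (hg : Q.sub.map j ⊔ V ≤ MulAut.conj g • A.sub) :
    hj.functor.map (OrbitFamily.homMk a h) ≫ hj.homMk Q A g hg =
      hj.homMk P A (j a * g) (le_conj_smul_mul (hj.map_sup_le_conj_smul h) hg) := by
  rw [functor_map_homMk]
  exact OrbitFamily.homMk_comp_homMk _ hg

/-- The morphisms `H/P ⟶ W/A` are classified by the double cosets `jH g A` with `V ≤ gAg⁻¹`. -/
theorem isMultiLeftAdjoint_functor : IsMultiLeftAdjoint hj.functor := fun A => by
  let s : Setoid {g : W // V ≤ MulAut.conj g • A.sub} :=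
    (DoubleCoset.setoid (j.range : Set W) A.sub).comap Subtype.val
  let t (x : Quotient s) : OrbitFamily 𝓗 := .mk _ (hj.comap_mem _ A.property _ x.out.2)
  let ε (x : Quotient s) : hj.functor.obj (t x) ⟶ A :=
    hj.homMk _ _ x.out.1 (sup_le (Subgroup.map_comap_le _ _) x.out.2)
  refine ⟨Quotient s, t, ε, fun P f => existsUnique_of_exists_of_unique ?_ ?_⟩
  · obtain ⟨g, hg, rfl⟩ := hj.exists_homMk_eq f
    let x : Quotient s := Quotient.mk s ⟨g, le_sup_right.trans hg⟩
    obtain ⟨_, ⟨h, rfl⟩, a, ha, hx⟩ := DoubleCoset.rel_iff.1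
      (Quotient.mk_out (s := s) ⟨g, le_sup_right.trans hg⟩)
    have hgA : ((j h * x.out.1 : W) : W ⧸ A.sub) = g :=
      (QuotientGroup.mk_mul_of_mem _ ha).symm.trans (congrArg QuotientGroup.mk hx.symm)
    have hP : P.sub ≤ MulAut.conj h • (t x).sub :=
      le_conj_smul_comap (conj_smul_eq_of_mk_eq hgA ▸ le_sup_left.trans hg)
    exact ⟨⟨x, OrbitFamily.homMk h hP⟩, (hj.functor_map_homMk_comp_homMk _ _).trans
      (hj.homMk_eq_homMk_iff.2 hgA)⟩
  · rintro ⟨x, v⟩ ⟨y, w⟩ hv hw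
    obtain ⟨h, hh, rfl⟩ : ∃ h hh, OrbitFamily.homMk h hh = v := ⟨_, _, OrbitFamily.homMk_rep v⟩
    obtain ⟨h', hh', rfl⟩ : ∃ h hh, OrbitFamily.homMk h hh = w := ⟨_, _, OrbitFamily.homMk_rep w⟩
    have hxy : ((j h * x.out.1 : W) : W ⧸ A.sub) = (j h' * y.out.1 : W) :=
      hj.homMk_eq_homMk_iff.1 ((hj.functor_map_homMk_comp_homMk hh _).symm.trans
        ((hv.trans hw.symm).trans (hj.functor_map_homMk_comp_homMk hh' _)))
    obtain rfl : x = y := by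
      rw [← x.out_eq, ← y.out_eq]
      refine Quotient.sound (DoubleCoset.rel_iff.2 ⟨j (h'⁻¹ * h), ⟨_, rfl⟩, _,
        QuotientGroup.eq.1 hxy, ?_⟩)
      simp [mul_assoc]
    congr 1
    exact OrbitFamily.homMk_eq_homMk_iff.2 (mk_eq_mk_comap_conj_smul hxy)

end IsOrbitInduction

end OrbitInduction

section RanPoint

variable {H W : Type u} [Group H] [Group W] {j : H →* W} {V : Subgroup W}
  {𝓗 : Set (Subgroup H)} {𝓐 : Set (Subgroup W)} {k l : Type*} [CommRing k] [CommRing l]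
  {M N : Type u} [AddCommGroup M] [Module k M] [AddCommGroup N] [Module l N]
  {σ : Representation k H M} {τ : Representation l W N} {L : Subgroup H} {K : Subgroup W}

namespace IsOrbitInduction

theorem map_bot_sup_le {B : Subgroup W} (h : V ≤ B) : (⊥ : Subgroup H).map j ⊔ V ≤ B :=
  sup_le (by simp only [Subgroup.map_bot, bot_le]) h

theorem disjoint_of_disjoint_map_sup (hinj : Function.Injective j) (hLK : L ≤ K.comap j)
    {P : Subgroup H} (h : Disjoint (P.map j ⊔ V) K) : Disjoint P L := by
  rw [Subgroup.disjoint_def] at h ⊢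
  exact fun hP hL => hinj ((h (le_sup_left (a := P.map j) (Subgroup.mem_map_of_mem j hP))
    (hLK hL)).trans j.map_one.symm)

variable [L.Normal] [K.Normal] (hj : IsOrbitInduction j V 𝓗 𝓐) {A : OrbitFamily 𝓐}
include hj

/-- The value at `g ∈ W` of an element of the right Kan extension of `invariantsAvoiding L σ 𝓗`,
regarded as a function on `{g | V ≤ gAg⁻¹}`. -/
noncomputable def ranPoint (g : W) (hg : V ≤ MulAut.conj g • A.sub)
    (x : (hj.functor.op.ran.obj (invariantsAvoiding L σ 𝓗)).obj (op A)) : M :=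
  (ranEval (hj.homMk (.mk ⊥ hj.bot_mem) A g (map_bot_sup_le hg)) x).1

variable {g : W} (hg : V ≤ MulAut.conj g • A.sub)
  (x y : (hj.functor.op.ran.obj (invariantsAvoiding L σ 𝓗)).obj (op A))

theorem ranPoint_add : hj.ranPoint g hg (x + y) = hj.ranPoint g hg x + hj.ranPoint g hg y :=
  congrArg Subtype.val (map_add (ranEval _).hom x y)

theorem ranPoint_zero :
    hj.ranPoint g hg (0 : (hj.functor.op.ran.obj (invariantsAvoiding L σ 𝓗)).obj (op A)) = 0 := by
  simpa only [add_zero, left_eq_add] using hj.ranPoint_add (L := L) (σ := σ) hg 0 0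

theorem ranPoint_map_mul {h : H} (hg' : V ≤ MulAut.conj (j h * g) • A.sub) :
    hj.ranPoint (j h * g) hg' x = σ h (hj.ranPoint g hg x) := by
  have hh : (OrbitFamily.mk ⊥ hj.bot_mem).sub ≤
      MulAut.conj h • (OrbitFamily.mk ⊥ hj.bot_mem).sub := bot_le
  have := congrArg Subtype.val (ranEval_map_comp (Φ := hj.functor) (OrbitFamily.homMk h hh)
    (hj.homMk _ A g (map_bot_sup_le hg)) x)
  rwa [invariantsAvoiding_map_homMk, functor_map_homMk_comp_homMk] at this

theorem ranPoint_eq_of_mk_eq {g' : W} (hg' : V ≤ MulAut.conj g' • A.sub)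
    (h : (g : W ⧸ A.sub) = g') : hj.ranPoint g hg x = hj.ranPoint g' hg' x := by
  unfold ranPoint
  rw [hj.homMk_eq_homMk_iff.2 h]

theorem coe_ranEval_homMk {P : OrbitFamily 𝓗} (hP : P.sub.map j ⊔ V ≤ MulAut.conj g • A.sub) :
    (ranEval (hj.homMk P A g hP) x).1 = hj.ranPoint g (le_sup_right.trans hP) x := by
  have hP1 : (OrbitFamily.mk ⊥ hj.bot_mem).sub ≤ MulAut.conj (1 : H) • P.sub := bot_le
  have h := congrArg Subtype.val (ranEval_map_comp (Φ := hj.functor) (OrbitFamily.homMk 1 hP1)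
    (hj.homMk P A g hP) x)
  rw [invariantsAvoiding_map_homMk, functor_map_homMk_comp_homMk] at h
  refine congr($(map_one σ) _).symm.trans (h.symm.trans (hj.ranPoint_eq_of_mk_eq ?_ x _ ?_))
  · simpa only [map_one, one_mul] using le_sup_right.trans hP
  · rw [map_one, one_mul]

theorem ranPoint_mem : hj.ranPoint g hg x ∈
    invariantsAvoidingSubgroup L σ ((MulAut.conj g • A.sub).comap j) := by
  rw [← hj.coe_ranEval_homMk x (P := .mk _ (hj.comap_mem _ A.property g hg))
    (sup_le (Subgroup.map_comap_le _ _) hg)]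
  exact Subtype.property _

theorem ranPoint_map {B : OrbitFamily 𝓐} {a : W} (ha : A.sub ≤ MulAut.conj a • B.sub)
    (y : (hj.functor.op.ran.obj (invariantsAvoiding L σ 𝓗)).obj (op B)) :
    hj.ranPoint g hg ((hj.functor.op.ran.obj (invariantsAvoiding L σ 𝓗)).map
      (OrbitFamily.homMk a ha).op y) = hj.ranPoint (g * a) (le_conj_smul_mul hg ha) y := by
  have := congrArg Subtype.val (ranEval_map (F := invariantsAvoiding L σ 𝓗)
    (OrbitFamily.homMk a ha) (hj.homMk (.mk ⊥ hj.bot_mem) A g (map_bot_sup_le hg)) y)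
  rwa [homMk_comp_homMk] at this

variable {x y} in
theorem ranPoint_ext (h : ∀ g hg, hj.ranPoint g hg x = hj.ranPoint g hg y) : x = y :=
  ran_ext fun P f => by
    obtain ⟨g, hg, rfl⟩ := hj.exists_homMk_eq f
    exact Subtype.ext ((hj.coe_ranEval_homMk x hg).trans
      ((h g _).trans (hj.coe_ranEval_homMk y hg).symm))

variable (hd : ∀ P ∈ 𝓗, Disjoint (P.map j ⊔ V) K → Disjoint P L) (π : N →+ M)
  (hπ : ∀ h n, π (τ (j h) n) = σ h (π n))

/-- The transformation `n ↦ π n`. -/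
noncomputable def restrictionHom :
    hj.functor.op ⋙ invariantsAvoiding K τ 𝓐 ⟶ invariantsAvoiding L σ 𝓗 where
  app P := AddCommGrpCat.ofHom ((π.comp (AddSubgroup.subtype _)).codRestrict
    (invariantsAvoidingSubgroup L σ P.unop.sub) fun n => ⟨fun a ha => by
      rw [AddMonoidHom.comp_apply, ← hπ]
      exact congrArg π (n.2.1 _ (le_sup_left (a := P.unop.sub.map j)
        (Subgroup.mem_map_of_mem j ha))), fun h =>
      (congrArg π (n.2.2 fun h' => h (hd _ P.unop.property h'))).trans (map_zero π)⟩)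
  naturality P Q φ := by
    ext n
    refine Subtype.ext ((congrArg π (invariantsAvoiding_map_homMk (A := hj.functor.obj Q.unop)
      (B := hj.functor.obj P.unop) (j (OrbitFamily.rep φ.unop))
      (hj.map_sup_le_conj_smul (OrbitFamily.le_conj_smul_rep φ.unop)) n)).trans (hπ _ _))

/-- The transformation `ξ ↦ (g ↦ π (g ξ))` to the right Kan extension. -/
noncomputable def toRan :
    invariantsAvoiding K τ 𝓐 ⟶ hj.functor.op.ran.obj (invariantsAvoiding L σ 𝓗) :=
  (hj.functor.op.ranAdjunction _).homEquiv _ _ (hj.restrictionHom hd π hπ)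

theorem ranPoint_toRan_app (ξ : (invariantsAvoiding K τ 𝓐).obj (op A)) :
    hj.ranPoint g hg ((hj.toRan hd π hπ).app (op A) ξ) = π (τ g ξ.1) :=
  (congrArg Subtype.val (ranEval_homEquiv_app (Φ := hj.functor) _ _ ξ)).trans
    (congrArg π (invariantsAvoiding_map_homMk (A := hj.functor.obj (.mk ⊥ hj.bot_mem)) _ _ ξ))

end IsOrbitInduction

end RanPoint

section ProdSubgroups

variable {p : ℕ} {G H : Type u} [Group G] [Group H]

theorem isPGroup_conj_smul {A : Subgroup G} (hA : IsPGroup p A) (g : G) :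
    IsPGroup p (MulAut.conj g • A : Subgroup G) :=
  hA.map _

theorem isPGroup_prod {P : Subgroup G} {Q : Subgroup H} (hP : IsPGroup p P)
    (hQ : IsPGroup p Q) : IsPGroup p (P.prod Q) := by
  have hker : IsPGroup p (MonoidHom.fst P Q).ker :=
    hQ.of_injective ((MonoidHom.snd P Q).comp (MonoidHom.fst P Q).ker.subtype) fun x y h =>
      Subtype.ext (Prod.ext (x.2.trans y.2.symm) h)
  have hPQ := (hP.to_subgroup ⊤).comap_of_ker_isPGroup (MonoidHom.fst P Q) hker
  rw [Subgroup.comap_top] at hPQ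
  exact (hPQ.of_equiv Subgroup.topEquiv).of_equiv (Subgroup.prodEquiv P Q).symm

variable (p G H) in
/-- The `p`-subgroups of `G × H` that are products of a subgroup of `G` and one of `H`. -/
def prodSubgroups : Set (Subgroup (G × H)) :=
  {A | IsPGroup p A ∧ ∀ x ∈ A, (x.1, 1) ∈ A}

theorem snd_mem_of_mem_prodSubgroups {A : Subgroup (G × H)} (hA : A ∈ prodSubgroups p G H)
    {x : G × H} (hx : x ∈ A) : (1, x.2) ∈ A := by
  simpa [Prod.mul_def] using A.mul_mem (A.inv_mem (hA.2 x hx)) hx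

theorem isReflectiveSubfamily_prodSubgroups :
    IsReflectiveSubfamily (prodSubgroups p G H) (pSubgroups p (G × H))
      fun A => (A.map (MonoidHom.fst G H)).prod (A.map (MonoidHom.snd G H)) where
  subset _ hA := hA.1
  mem _ hA := ⟨isPGroup_prod (hA.map _) (hA.map _), fun x hx => ⟨hx.1, Subgroup.one_mem _⟩⟩
  le _ _ := Subgroup.le_prod_iff.2 ⟨le_rfl, le_rfl⟩
  le_conj_smul := by
    rintro P - A hA g hP ⟨_, _⟩ ⟨⟨x, hx, rfl⟩, ⟨y, hy, rfl⟩⟩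
    have hxy := A.mul_mem (hA.2 _ (mem_conj_smul_iff.1 (hP hx)))
      (snd_mem_of_mem_prodSubgroups hA (mem_conj_smul_iff.1 (hP hy)))
    simpa [mem_conj_smul_iff, Prod.mul_def] using hxy

theorem isOrbitInduction_id_prodMap_subtype (Q : Subgroup H) :
    IsOrbitInduction ((MonoidHom.id G).prodMap Q.subtype) ⊥ (prodSubgroups p G Q)
      (prodSubgroups p G H) where
  bot_mem := ⟨IsPGroup.of_bot, by simp⟩
  map_sup_mem P hP := by
    rw [sup_bot_eq]
    refine ⟨hP.1.map _, ?_⟩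
    rintro _ ⟨x, hx, rfl⟩
    exact ⟨_, hP.2 x hx, rfl⟩
  comap_mem A hA g _ := by
    refine ⟨(isPGroup_conj_smul hA.1 g).comap_of_injective _
      (Function.injective_id.prodMap Q.subtype_injective), fun x hx => ?_⟩
    simpa [mem_conj_smul_iff, Prod.mul_def] using hA.2 _ (mem_conj_smul_iff.1 hx)
  le_conj_smul _ := bot_le

end ProdSubgroups

section Transfer

theorem sum_eq_zero_of_isPGroup {p : ℕ} [Fact p.Prime] {P X M : Type*} [Group P]
    [AddCommGroup M] (hP : IsPGroup p P) [MulAction P X] [Fintype X]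
    (hM : ∀ m : M, p • m = 0) (f : X → M) (hf : ∀ (b : P) x, f (b • x) = f x)
    (hf_fixed : ∀ x, (∀ b : P, b • x = x) → f x = 0) : ∑ x, f x = 0 := by
  classical
  rw [← Finset.sum_fiberwise_of_maps_to (s := Finset.univ) (t := Finset.univ.image f) (g := f)
    (fun x _ => Finset.mem_image_of_mem f (Finset.mem_univ x))]
  refine Finset.sum_eq_zero fun m _ => ?_
  rw [Finset.sum_congr rfl (fun x hx => (Finset.mem_filter.1 hx).2), Finset.sum_const]
  by_cases hm : m = 0
  · rw [hm, smul_zero]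
  let Y : SubMulAction P X := ⟨{x | f x = m}, fun b {x} hx => (hf b x).trans hx⟩
  have hY := hP.card_modEq_card_fixedPoints Y
  have hfix : IsEmpty (MulAction.fixedPoints P Y) := ⟨fun y => hm <| by
    rw [← y.1.2]
    exact hf_fixed _ fun b => congrArg Subtype.val (y.2 b)⟩
  rw [Nat.card_eq_zero.2 (Or.inl hfix)] at hY
  have hcard : Nat.card Y = (Finset.univ.filter fun x => f x = m).card := by
    rw [← Nat.card_eq_finsetCard]
    exact Nat.card_congr (Equiv.subtypeEquivRight fun x => by
      rw [Finset.mem_filter_univ]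
      exact Iff.rfl)
  obtain ⟨c, hc⟩ := Nat.modEq_zero_iff_dvd.1 hY
  rw [← hcard, hc, mul_comm, mul_smul, hM, smul_zero]

variable {p : ℕ} {G H : Type u} [Group G] [Group H] {Q : Subgroup H} {k : Type*} [CommRing k]
  {M : Type u} [AddCommGroup M] [Module k M] {ρ : Representation k (G × H) M}

/-- The functor on the orbits of `G × H` induced from the atomic functor of the restriction of
`ρ` to `G × Q`. -/
noncomputable abbrev ranRestrict (p : ℕ) (Q : Subgroup H) (ρ : Representation k (G × H) M) :
    (OrbitFamily (prodSubgroups p G H))ᵒᵖ ⥤ AddCommGrpCat.{u} :=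
  (isOrbitInduction_id_prodMap_subtype (G := G) Q).functor.op.ran.obj
    (invariantsAvoiding ⊤ (ρ.comp ((MonoidHom.id G).prodMap Q.subtype)) (prodSubgroups p G Q))

/-- The value at `x ∈ G × H` of an element of `ranRestrict p Q ρ`. -/
noncomputable abbrev ranRestrictPoint {A : OrbitFamily (prodSubgroups p G H)} (x : G × H)
    (s : (ranRestrict p Q ρ).obj (op A)) : M :=
  (isOrbitInduction_id_prodMap_subtype Q).ranPoint x bot_le s

variable (p Q ρ) in
/-- The transformation `m ↦ (x ↦ x m)`. -/
noncomputable def toRanRestrict :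
    invariantsAvoiding ⊤ ρ (prodSubgroups p G H) ⟶ ranRestrict p Q ρ :=
  (isOrbitInduction_id_prodMap_subtype Q).toRan
    (fun _ _ => IsOrbitInduction.disjoint_of_disjoint_map_sup
      (Function.injective_id.prodMap Q.subtype_injective) le_top)
    (AddMonoidHom.id M) fun _ _ => rfl

variable {A B : OrbitFamily (prodSubgroups p G H)} (s : (ranRestrict p Q ρ).obj (op A))

theorem ranRestrictPoint_eq_zero {x a : G × H} (haQ : a.2 ∈ Q) (ha : a ≠ 1)
    (hax : x⁻¹ * a * x ∈ A.sub) : ranRestrictPoint x s = 0 := by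
  refine ((isOrbitInduction_id_prodMap_subtype Q).ranPoint_mem bot_le s).2 fun h => ha ?_
  have hmem : (a.1, ⟨a.2, haQ⟩) ∈ (MulAut.conj x • A.sub).comap
      ((MonoidHom.id G).prodMap Q.subtype) := mem_conj_smul_iff.2 hax
  have h1 := Subgroup.disjoint_def.1 h hmem (Subgroup.mem_top _)
  exact congrArg ((MonoidHom.id G).prodMap Q.subtype) h1

theorem ranRestrictPoint_mul_left (g g' : G) (h : H) :
    ranRestrictPoint (g * g', h) s = ρ (g, 1) (ranRestrictPoint (g', h) s) := by
  have h1 := (isOrbitInduction_id_prodMap_subtype Q).ranPoint_map_mul (h := ((g, 1) : G × Q))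
    (g := (g', h)) bot_le s bot_le
  simpa using h1

/-- The sum of the values at the points `(1, q⁻¹)` for `q ∈ H/Q`. -/
noncomputable def cosetSum [Fintype (H ⧸ Q)] : M :=
  ∑ q : H ⧸ Q, ranRestrictPoint (1, q.out⁻¹) s

theorem cosetSum_add [Fintype (H ⧸ Q)] (t : (ranRestrict p Q ρ).obj (op A)) :
    cosetSum (s + t) = cosetSum s + cosetSum t := by
  rw [cosetSum, cosetSum, cosetSum, ← Finset.sum_add_distrib]
  exact Finset.sum_congr rfl fun q _ =>
    (isOrbitInduction_id_prodMap_subtype Q).ranPoint_add bot_le s t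

variable (hρ : ∀ h, ρ (1, h) = 1)
include hρ

theorem ranRestrictPoint_inv_eq_of_mk_eq (g : G) {y z : H} (hyz : (y : H ⧸ Q) = z) :
    ranRestrictPoint (g, y⁻¹) s = ranRestrictPoint (g, z⁻¹) s := by
  have h1 := (isOrbitInduction_id_prodMap_subtype Q).ranPoint_map_mul
    (h := ((1, ⟨y⁻¹ * z, QuotientGroup.eq.1 hyz⟩) : G × Q)) (g := (g, z⁻¹)) bot_le s bot_le
  simpa [hρ] using h1

variable [Fintype (H ⧸ Q)]

theorem sum_ranRestrictPoint_mul (x : G × H) :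
    ∑ q : H ⧸ Q, ranRestrictPoint ((1, q.out⁻¹) * x) s =
      ρ x (cosetSum s) := by
  have hx : ρ x = ρ (x.1, 1) := by
    rw [← mul_one (ρ (x.1, 1)), ← hρ x.2, ← map_mul, Prod.mk_mul_mk, mul_one, one_mul]
  rw [hx, cosetSum, map_sum, ← (MulAction.bijective x.2).sum_comp]
  refine Finset.sum_congr rfl fun q _ => ?_
  have hq : ((x.2⁻¹ * (x.2 • q).out : H) : H ⧸ Q) = (q.out : H) := by
    rw [← smul_eq_mul, ← MulAction.Quotient.smul_coe, QuotientGroup.out_eq', inv_smul_smul,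
      QuotientGroup.out_eq']
  rw [← ranRestrictPoint_mul_left, mul_one, ← ranRestrictPoint_inv_eq_of_mk_eq s hρ _ hq,
    mul_inv_rev, inv_inv, Prod.mul_def, one_mul]

theorem apply_cosetSum_of_mem {a : G × H} (ha : a ∈ A.sub) :
    ρ a (cosetSum s) = cosetSum s := by
  rw [← sum_ranRestrictPoint_mul s hρ]
  exact Finset.sum_congr rfl fun q _ =>
    (isOrbitInduction_id_prodMap_subtype Q).ranPoint_eq_of_mk_eq _ s _
      (QuotientGroup.mk_mul_of_mem _ ha)

theorem cosetSum_eq_zero_of_snd [Fact p.Prime] (hM : ∀ m : M, p • m = 0) {b : H}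
    (hb : (1, b) ∈ A.sub) (hb1 : b ≠ 1) : cosetSum s = 0 := by
  have hP : IsPGroup p (A.sub.comap (MonoidHom.inr G H)) :=
    A.property.1.comap_of_injective _ fun _ _ h => congrArg Prod.snd h
  refine sum_eq_zero_of_isPGroup hP hM _ (fun c q => ?_) fun q hq => ?_
  · have hcq : (((c • q).out : H) : H ⧸ Q) = (c * q.out : H) := by
      rw [QuotientGroup.out_eq', ← smul_eq_mul, ← MulAction.Quotient.smul_coe,
        QuotientGroup.out_eq']
      rfl
    rw [ranRestrictPoint_inv_eq_of_mk_eq s hρ 1 hcq]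
    refine (isOrbitInduction_id_prodMap_subtype Q).ranPoint_eq_of_mk_eq _ s _
      (QuotientGroup.eq.2 ?_)
    simpa using (show (1, c.1) ∈ A.sub from c.2)
  · have hbq : ((q.out : H) : H ⧸ Q) = (b * q.out : H) := by
      rw [← smul_eq_mul, ← MulAction.Quotient.smul_coe, QuotientGroup.out_eq']
      exact (hq ⟨b, hb⟩).symm
    refine ranRestrictPoint_eq_zero s (a := (1, q.out⁻¹ * (b * q.out))) (QuotientGroup.eq.1 hbq)
      (fun h => hb1 ?_) ?_
    · exact mul_eq_right.1 (inv_mul_eq_one.1 (congrArg Prod.snd h)).symm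
    · simpa [mul_assoc] using hb

theorem cosetSum_eq_zero [Fact p.Prime] (hM : ∀ m : M, p • m = 0)
    (hA : ¬ Disjoint A.sub ⊤) : cosetSum s = 0 := by
  obtain ⟨⟨a, b⟩, hab, hab1⟩ := A.sub.bot_or_exists_ne_one.resolve_left (mt disjoint_top.2 hA)
  by_cases hb1 : b = 1
  · subst hb1
    refine Finset.sum_eq_zero fun q _ => ranRestrictPoint_eq_zero s (a := (a, 1)) Q.one_mem hab1 ?_
    simpa using hab
  · exact cosetSum_eq_zero_of_snd s hρ hM
      (snd_mem_of_mem_prodSubgroups A.property hab) hb1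

theorem cosetSum_map {a : G × H} (ha : A.sub ≤ MulAut.conj a • B.sub)
    (t : (ranRestrict p Q ρ).obj (op B)) :
    cosetSum ((ranRestrict p Q ρ).map (OrbitFamily.homMk a ha).op t) = ρ a (cosetSum t) := by
  rw [← sum_ranRestrictPoint_mul t hρ, cosetSum]
  exact Finset.sum_congr rfl fun q _ =>
    (isOrbitInduction_id_prodMap_subtype Q).ranPoint_map bot_le ha t

variable (Q) in
/-- The transfer `s ↦ c ∑ s(1, q⁻¹)`, the sum being over `q ∈ H/Q`. -/
noncomputable def transferHom [Fact p.Prime] (hM : ∀ m : M, p • m = 0) (c : k) :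
    ranRestrict p Q ρ ⟶ invariantsAvoiding ⊤ ρ (prodSubgroups p G H) where
  app A := AddCommGrpCat.ofHom (AddMonoidHom.mk' (fun s => ⟨c • cosetSum s,
      fun a ha => by rw [map_smul, apply_cosetSum_of_mem s hρ ha],
      fun hA => by rw [cosetSum_eq_zero s hρ hM hA, smul_zero]⟩)
    fun s t => Subtype.ext ((congrArg (c • ·) (cosetSum_add s t)).trans (smul_add _ _ _)))
  naturality A B φ := by
    ext s
    obtain ⟨a, ha, hφ⟩ : ∃ a ha, OrbitFamily.homMk a ha = φ.unop :=
      ⟨_, _, OrbitFamily.homMk_rep φ.unop⟩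
    obtain rfl : (OrbitFamily.homMk a ha).op = φ := congrArg Quiver.Hom.op hφ
    refine Subtype.ext (Eq.trans ?_ (invariantsAvoiding_map_homMk a ha _).symm)
    exact (congrArg (c • ·) (cosetSum_map hρ ha s)).trans (map_smul (ρ a) c _).symm

theorem cosetSum_toRanRestrict_app
    (m : (invariantsAvoiding ⊤ ρ (prodSubgroups p G H)).obj (op A)) :
    cosetSum ((toRanRestrict p Q ρ).app (op A) m) = (Nat.card (H ⧸ Q) : k) • m.1 := by
  have hm (q : H ⧸ Q) :
      ranRestrictPoint (1, q.out⁻¹) ((toRanRestrict p Q ρ).app (op A) m) = m.1 :=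
    ((isOrbitInduction_id_prodMap_subtype Q).ranPoint_toRan_app _ _ _ _ m).trans
      congr($(hρ _) m.1)
  rw [cosetSum, Finset.sum_congr rfl fun q _ => hm q, Finset.sum_const, Finset.card_univ,
    ← Nat.card_eq_fintype_card, Nat.cast_smul_eq_nsmul]

/-- An atomic functor is a retract of the one induced from its restriction to `G × Q` if the index
of `Q` is invertible. -/
noncomputable def retractRanRestrict [Fact p.Prime] (hM : ∀ m : M, p • m = 0) {c : k}
    (hc : c * Nat.card (H ⧸ Q) = 1) :
    Retract (invariantsAvoiding ⊤ ρ (prodSubgroups p G H)) (ranRestrict p Q ρ) where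
  i := toRanRestrict p Q ρ
  r := transferHom Q hρ hM c
  retract := by
    ext A m
    exact Subtype.ext ((congrArg (c • ·) (cosetSum_toRanRestrict_app hρ m)).trans
      ((smul_smul _ _ _).trans ((congrArg (· • m.1) hc).trans (one_smul k m.1))))

end Transfer

section Vanishing

variable {p : ℕ} {G H : Type u} [Group G] [Group H] {k : Type*} [CommRing k]
  {M : Type u} [AddCommGroup M] [Module k M]

theorem higherLimit_invariantsAvoiding_prodSubgroups_iso (ρ : Representation k (G × H) M) (i : ℕ) :
    Nonempty (higherLimit i (invariantsAvoiding ⊤ ρ (prodSubgroups p G H)) ≅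
      higherLimit i (invariantsAvoiding ⊤ ρ (pSubgroups p (G × H)))) :=
  isReflectiveSubfamily_prodSubgroups.higherLimit_inclusion_iso i
    (invariantsAvoiding ⊤ ρ (pSubgroups p (G × H)))

theorem isZero_higherLimit_invariantsAvoiding_of_isPGroup [Nontrivial H]
    (hH : IsPGroup p H) (ρ : Representation k (G × H) M) (i : ℕ) :
    IsZero (higherLimit i (invariantsAvoiding ⊤ ρ (pSubgroups p (G × H)))) := by
  have hV : IsPGroup p ((⊥ : Subgroup G).prod (⊤ : Subgroup H)) :=
    isPGroup_prod IsPGroup.of_bot (hH.to_subgroup ⊤)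
  have hV1 : (⊥ : Subgroup G).prod (⊤ : Subgroup H) ≠ ⊥ := by
    simp [Subgroup.prod_eq_bot_iff]
  exact isZero_higherLimit_invariantsAvoiding_of_normal hV (mt disjoint_top.1 hV1) ρ i

theorem isZero_higherLimit_invariantsAvoiding_prod [Fact p.Prime] [Finite H]
    (hH : p ∣ Nat.card H) [Module (ZMod p) M] (ρ : Representation (ZMod p) (G × H) M)
    (hρ : ∀ h, ρ (1, h) = 1) (i : ℕ) :
    IsZero (higherLimit i (invariantsAvoiding ⊤ ρ (pSubgroups p (G × H)))) := by
  obtain ⟨Q⟩ := Sylow.nonempty (p := p) (G := H)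
  have := Fintype.ofFinite (H ⧸ Q.1)
  have hQ : Nontrivial Q.1 := (Subgroup.nontrivial_iff_ne_bot _).2 (Q.ne_bot_of_dvd_card hH)
  have hindex : (Nat.card (H ⧸ Q.1) : ZMod p) ≠ 0 := fun h =>
    Q.not_dvd_index ((ZMod.natCast_eq_zero_iff _ _).1 h)
  obtain ⟨e⟩ := higherLimit_invariantsAvoiding_prodSubgroups_iso (p := p) ρ i
  obtain ⟨e₁⟩ := (isOrbitInduction_id_prodMap_subtype (G := G) (p := p)
    Q.1).isMultiLeftAdjoint_functor.higherLimit_ran_iso i (invariantsAvoiding ⊤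
      (ρ.comp ((MonoidHom.id G).prodMap Q.1.subtype)) (prodSubgroups p G Q.1))
  obtain ⟨e₂⟩ := higherLimit_invariantsAvoiding_prodSubgroups_iso (p := p)
    (ρ.comp ((MonoidHom.id G).prodMap Q.1.subtype)) i
  refine (isZero_higherLimit_of_retract i (retractRanRestrict hρ (fun m => ?_)
    (inv_mul_cancel₀ hindex)) ?_).of_iso e.symm
  · rw [← Nat.cast_smul_eq_nsmul (ZMod p), CharP.cast_eq_zero, zero_smul]
  · exact (isZero_higherLimit_invariantsAvoiding_of_isPGroup Q.2 _ i).of_iso (e₁ ≪≫ e₂)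

end Vanishing

theorem disjoint_range_of_disjoint_comap_top {H W : Type u} [Group H] [Group W] {j : H →* W}
    {B : Subgroup W} (h : Disjoint (B.comap j) ⊤) : Disjoint B j.range := by
  rw [Subgroup.disjoint_def] at h ⊢
  rintro _ hB ⟨x, rfl⟩
  rw [h hB (Subgroup.mem_top x), map_one]

section WreathGroup

open RegularWreathProduct

variable {D Q : Type*} [Group D] [Group Q]

variable (D Q) in
/-- The base group `Q → D` of the wreath product `D ≀ Q`. -/
abbrev baseGroup : Subgroup (D ≀ᵣ Q) := (rightHom : D ≀ᵣ Q →* Q).ker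

variable (D Q) in
open Classical in
/-- The inclusion of the base group, with the factor at `1` split off. -/
noncomputable def baseHom : D × ({x : Q // x ≠ 1} → D) →* D ≀ᵣ Q where
  toFun h := ⟨fun x => if hx : x = 1 then h.1 else h.2 ⟨x, hx⟩, 1⟩
  map_one' := by
    ext x
    · simp
    · rfl
  map_mul' a b := by
    ext x
    · by_cases hx : x = 1 <;> simp [hx]
    · simp

theorem baseHom_left_one (h : D × ({x : Q // x ≠ 1} → D)) : (baseHom D Q h).left 1 = h.1 :=
  dif_pos rfl

theorem baseHom_right (h : D × ({x : Q // x ≠ 1} → D)) : (baseHom D Q h).right = 1 := rfl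

theorem baseHom_left (w : D ≀ᵣ Q) :
    baseHom D Q (w.left 1, fun x => w.left x.1) = ⟨w.left, 1⟩ := by
  ext x
  · by_cases hx : x = 1 <;> simp [baseHom, hx]
  · rfl

theorem baseHom_mul_inl_right (w : D ≀ᵣ Q) :
    baseHom D Q (w.left 1, fun x => w.left x.1) * inl w.right = w := by
  rw [baseHom_left]
  ext x <;> simp

theorem comap_baseHom_baseGroup : (baseGroup D Q).comap (baseHom D Q) = ⊤ :=
  eq_top_iff.2 fun h _ => baseHom_right h

theorem range_baseHom : (baseHom D Q).range = baseGroup D Q := by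
  ext w
  refine ⟨?_, fun hw => ⟨_, (baseHom_left w).trans (RegularWreathProduct.ext rfl hw.symm)⟩⟩
  rintro ⟨h, rfl⟩
  exact baseHom_right h

theorem baseHom_injective : Function.Injective (baseHom D Q) := fun a b hab => by
  refine Prod.ext ?_ (funext fun x => ?_)
  · rw [← baseHom_left_one a, hab, baseHom_left_one]
  · simpa [baseHom, x.2] using congrArg (fun w => w.left x.1) hab

end WreathGroup

section WreathBase

open RegularWreathProduct

variable {p : ℕ} {Γ : Type u} [Group Γ]

theorem isOrbitInduction_baseHom : IsOrbitInduction (baseHom Γ (CyclicGroup p)) ⊥ (pSubgroups p _)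
    (pSubgroups p (Γ ≀ᵣ CyclicGroup p)) where
  bot_mem := IsPGroup.of_bot
  map_sup_mem _ hP := by
    rw [sup_bot_eq]
    exact hP.map _
  comap_mem _ hA g _ := (isPGroup_conj_smul hA g).comap_of_injective _ baseHom_injective
  le_conj_smul _ := bot_le

variable {k : Type*} [CommRing k] {M : Type u} [AddCommGroup M] [Module k M]
  (ρ : Representation k Γ M)

theorem wreathRep_apply (w : Γ ≀ᵣ CyclicGroup p) (ξ : CyclicGroup p → M) (x : CyclicGroup p) :
    wreathRep ρ w ξ x = ρ (w.left x) (ξ (w.right⁻¹ * x)) := rfl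

theorem wreathRep_inl_apply (c : CyclicGroup p) (ξ : CyclicGroup p → M) (x : CyclicGroup p) :
    wreathRep ρ (inl c) ξ x = ξ (c⁻¹ * x) := by
  simp [wreathRep_apply]

theorem wreathRep_inl_inv_apply_one (c : CyclicGroup p) (ξ : CyclicGroup p → M) :
    wreathRep ρ (inl c⁻¹) ξ 1 = ξ c := by
  rw [wreathRep_inl_apply, inv_inv, mul_one]

/-- The representation of `Γ × Γ^(p-1)` on the factor of `M^p` at `1`. -/
abbrev baseRep (p : ℕ) : Representation k (Γ × ({x : CyclicGroup p // x ≠ 1} → Γ)) M :=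
  ρ.comp (MonoidHom.fst _ _)

theorem wreathRep_baseHom_apply_one (h : Γ × ({x : CyclicGroup p // x ≠ 1} → Γ))
    (ξ : CyclicGroup p → M) :
    wreathRep ρ (baseHom Γ (CyclicGroup p) h) ξ 1 = baseRep ρ p h (ξ 1) := by
  rw [wreathRep_apply, baseHom_left_one, baseHom_right, inv_one, one_mul]
  rfl

/-- The transformation `ξ ↦ (g ↦ (g ξ)(1))`. -/
noncomputable def toRanBase (p : ℕ) :
    invariantsAvoiding (baseGroup Γ (CyclicGroup p)) (wreathRep ρ) (pSubgroups p _) ⟶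
      isOrbitInduction_baseHom.functor.op.ran.obj
        (invariantsAvoiding ⊤ (baseRep ρ p) (pSubgroups p _)) :=
  isOrbitInduction_baseHom.toRan (fun _ _ h => IsOrbitInduction.disjoint_of_disjoint_map_sup
      baseHom_injective comap_baseHom_baseGroup.ge h)
    (Pi.evalAddMonoidHom _ 1) (wreathRep_baseHom_apply_one ρ)

variable {A : OrbitFamily (pSubgroups p (Γ ≀ᵣ CyclicGroup p))}

theorem injective_toRanBase_app : Function.Injective ((toRanBase ρ p).app (op A)) :=
  fun ξ η h => Subtype.ext (funext fun x => by
    have hx : wreathRep ρ (inl x⁻¹) ξ.1 1 = wreathRep ρ (inl x⁻¹) η.1 1 :=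
      ((isOrbitInduction_baseHom.ranPoint_toRan_app bot_le _ _ _ ξ).symm.trans
        (congrArg (isOrbitInduction_baseHom.ranPoint _ bot_le) h)).trans
        (isOrbitInduction_baseHom.ranPoint_toRan_app bot_le _ _ _ η)
    rwa [wreathRep_inl_inv_apply_one, wreathRep_inl_inv_apply_one] at hx)

theorem surjective_toRanBase_app : Function.Surjective ((toRanBase ρ p).app (op A)) := by
  intro s
  let hj := isOrbitInduction_baseHom (p := p) (Γ := Γ)
  let ξ : CyclicGroup p → M := fun x => hj.ranPoint (inl x⁻¹) bot_le s
  have hξ : ∀ g, wreathRep ρ g ξ 1 = hj.ranPoint g bot_le s := fun g => by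
    have h := hj.ranPoint_map_mul (g := inl g.right) (h := (g.left 1, fun x => g.left x.1))
      bot_le s bot_le
    simp only [baseHom_mul_inl_right] at h
    rw [h, wreathRep_apply]
    simp only [ξ, mul_one, inv_inv]
    rfl
  have hξA : ∀ a ∈ A.sub, wreathRep ρ a ξ = ξ := fun a ha => funext fun x => by
    rw [← wreathRep_inl_inv_apply_one ρ x (wreathRep ρ a ξ), ← Module.End.mul_apply,
      ← map_mul, hξ]
    exact hj.ranPoint_eq_of_mk_eq _ s bot_le (QuotientGroup.mk_mul_of_mem _ ha)
  have hξ_zero : ¬ Disjoint A.sub (baseGroup Γ (CyclicGroup p)) → ξ = 0 := fun h =>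
    funext fun x => (hj.ranPoint_mem bot_le s).2 fun h' => h (disjoint_conj_smul_iff.1
      (range_baseHom (D := Γ) (Q := CyclicGroup p) ▸ disjoint_range_of_disjoint_comap_top h'))
  refine ⟨⟨ξ, hξA, hξ_zero⟩, hj.ranPoint_ext fun g _ => ?_⟩
  exact (hj.ranPoint_toRan_app _ _ _ _ _).trans (hξ g)

theorem isZero_higherLimit_invariantsAvoiding_baseGroup [Fact p.Prime] [Finite Γ]
    (hp : p ∣ Nat.card Γ) [Module (ZMod p) M] (ρ : Representation (ZMod p) Γ M) (i : ℕ) :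
    IsZero (higherLimit i
      (invariantsAvoiding (baseGroup Γ (CyclicGroup p)) (wreathRep ρ) (pSubgroups p _))) := by
  have : Nontrivial (CyclicGroup p) := inferInstanceAs (Nontrivial (ZMod p))
  have : Finite (CyclicGroup p) := inferInstanceAs (Finite (ZMod p))
  have hΓ : p ∣ Nat.card ({x : CyclicGroup p // x ≠ 1} → Γ) := by
    obtain ⟨x, hx⟩ := exists_ne (1 : CyclicGroup p)
    have : Nonempty {x : CyclicGroup p // x ≠ 1} := ⟨⟨x, hx⟩⟩
    rw [Nat.card_fun]
    exact dvd_pow hp Nat.card_pos.ne'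
  have (A : (OrbitFamily (pSubgroups p (Γ ≀ᵣ CyclicGroup p)))ᵒᵖ) :
      IsIso ((toRanBase ρ p).app A) :=
    (ConcreteCategory.isIso_iff_bijective _).2
      ⟨injective_toRanBase_app ρ, surjective_toRanBase_app ρ⟩
  have : IsIso (toRanBase ρ p) := NatIso.isIso_of_isIso_app _
  obtain ⟨e⟩ := isOrbitInduction_baseHom.isMultiLeftAdjoint_functor.higherLimit_ran_iso i
    (invariantsAvoiding ⊤ (baseRep ρ p) (pSubgroups p _))
  refine IsZero.of_iso ?_ (higherLimitIso i (asIso (toRanBase ρ p)) ≪≫ e)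
  exact isZero_higherLimit_invariantsAvoiding_prod hΓ _ (fun h => by simp) i

end WreathBase

section TopSubgroup

open RegularWreathProduct

theorem not_disjoint_center_of_isPGroup {p : ℕ} [Fact p.Prime] {P : Type*} [Group P]
    (hP : IsPGroup p P) {N : Subgroup P} [N.Normal] [Finite N] (hN : N ≠ ⊥) :
    ¬ Disjoint N (Subgroup.center P) := by
  have : Nontrivial N := N.nontrivial_iff_ne_bot.2 hN
  have hcard : p ∣ Nat.card N := by
    obtain ⟨n, hn0, hn⟩ := (hP.to_subgroup N).nontrivial_iff_card.1 inferInstance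
    exact hn ▸ dvd_pow_self _ hn0.ne'
  have hP' : IsPGroup p (ConjAct P) := hP.of_equiv ConjAct.toConjAct
  obtain ⟨z, hz, hz1⟩ :=
    hP'.exists_fixed_point_of_prime_dvd_card_of_fixed_point N hcard (a := 1) smul_one
  have hzc : z.1 ∈ Subgroup.center P := Subgroup.mem_center_iff.2 fun g =>
    mul_inv_eq_iff_eq_mul.1 (congrArg Subtype.val (hz (ConjAct.toConjAct g)))
  exact fun h => hz1 (Subtype.ext (Subgroup.disjoint_def.1 h z.2 hzc).symm)

variable {D Q : Type*} [Group D] [Group Q]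

variable (D Q) in
/-- The complement `Q` of the base group of the wreath product `D ≀ Q`. -/
abbrev topSubgroup : Subgroup (D ≀ᵣ Q) := (inl : Q →* D ≀ᵣ Q).range

variable (D Q) in
/-- The diagonal inclusion of `D`. -/
def diagHom : D →* D ≀ᵣ Q where
  toFun d := ⟨fun _ => d, 1⟩
  map_one' := rfl
  map_mul' _ _ := by ext <;> simp

theorem diagHom_injective : Function.Injective (diagHom D Q) := fun _ _ h =>
  congrFun (congrArg RegularWreathProduct.left h) 1

theorem comap_diagHom_baseGroup : (baseGroup D Q).comap (diagHom D Q) = ⊤ :=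
  eq_top_iff.2 fun _ _ => MonoidHom.mem_ker.2 rfl

theorem commute_diagHom_inl (d : D) (c : Q) : Commute (diagHom D Q d) (inl c) := by
  ext <;> simp [diagHom]

theorem eq_diagHom_mul_inl {w : D ≀ᵣ Q} (h : ∀ c, Commute w (inl c)) :
    w = diagHom D Q (w.left 1) * inl w.right := by
  ext x
  · simpa [diagHom] using congrFun (congrArg RegularWreathProduct.left (h x)) x
  · simp [diagHom]

theorem eq_diagHom_mul_inl_of_le_conj_smul {Q : Type*} [CommGroup Q] {w : D ≀ᵣ Q}
    (h : topSubgroup D Q ≤ MulAut.conj w • topSubgroup D Q) :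
    w = diagHom D Q (w.left 1) * inl w.right := eq_diagHom_mul_inl fun c => by
  obtain ⟨d, hd⟩ := mem_conj_smul_iff.1 (h ⟨c, rfl⟩)
  obtain rfl : d = c := by simpa using congrArg RegularWreathProduct.right hd
  exact (eq_inv_mul_iff_mul_eq.1 (hd.trans (mul_assoc _ _ _)))

theorem disjoint_topSubgroup_baseGroup : Disjoint (topSubgroup D Q) (baseGroup D Q) := by
  rw [Subgroup.disjoint_def]
  rintro _ ⟨c, rfl⟩ (hc : c = 1)
  rw [hc, map_one]

theorem topSubgroup_eq_of_le {B : Subgroup (D ≀ᵣ Q)} (hB : topSubgroup D Q ≤ B)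
    (hd : Disjoint B (baseGroup D Q)) : topSubgroup D Q = B := by
  refine le_antisymm hB fun b hb => ⟨b.right, ?_⟩
  rw [eq_comm, ← mul_inv_eq_one]
  exact Subgroup.disjoint_def.1 hd (B.mul_mem hb (B.inv_mem (hB ⟨_, rfl⟩)))
    (MonoidHom.mem_ker.2 (by simp))

theorem topSubgroup_ne_bot [Nontrivial Q] : topSubgroup D Q ≠ ⊥ := by
  obtain ⟨c, hc⟩ := exists_ne (1 : Q)
  exact fun h => hc (congrArg RegularWreathProduct.right
    (Subgroup.mem_bot.1 (h ▸ ⟨c, rfl⟩ : (inl c : D ≀ᵣ Q) ∈ (⊥ : Subgroup (D ≀ᵣ Q)))))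

/-- The witness `x ↦ (τ x⁻¹)(1)` expresses that `H¹` of a coinduced module vanishes. -/
theorem exists_conj_eq_of_section (τ : Q →* D ≀ᵣ Q) (hτ : ∀ c, (τ c).right = c) :
    ∃ g : D ≀ᵣ Q, ∀ c, g⁻¹ * inl c * g = τ c := by
  refine ⟨⟨fun x => (τ x⁻¹).left 1, 1⟩, fun c => RegularWreathProduct.ext (funext fun x => ?_) ?_⟩
  · have h : (τ (x⁻¹ * c)).left 1 = (τ x⁻¹).left 1 * (τ c).left x := by
      rw [map_mul, mul_left, hτ]
      simp
    simp [-map_mul, -map_inv, h]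
  · simp [hτ]

theorem exists_topSubgroup_le_conj_smul {A : Subgroup (D ≀ᵣ Q)}
    (hA : Disjoint A (baseGroup D Q)) (hQ : A.map rightHom = ⊤) :
    ∃ g : D ≀ᵣ Q, topSubgroup D Q ≤ MulAut.conj g • A := by
  have hinj : Function.Injective ((rightHom : D ≀ᵣ Q →* Q).comp A.subtype) :=
    (injective_iff_map_eq_one _).2 fun a ha =>
      Subtype.ext (Subgroup.disjoint_def.1 hA a.2 ha)
  have hsurj : Function.Surjective ((rightHom : D ≀ᵣ Q →* Q).comp A.subtype) := by
    rw [← MonoidHom.range_eq_top, MonoidHom.range_comp, Subgroup.range_subtype, hQ]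
  let e := MulEquiv.ofBijective _ ⟨hinj, hsurj⟩
  obtain ⟨g, hg⟩ := exists_conj_eq_of_section (A.subtype.comp e.symm.toMonoidHom)
    e.apply_symm_apply
  refine ⟨g, ?_⟩
  rintro _ ⟨c, rfl⟩
  rw [mem_conj_smul_iff, hg]
  exact Subtype.property _

theorem disjoint_baseGroup_of_disjoint_comap_diagHom {p : ℕ} [Fact p.Prime]
    {B : Subgroup (D ≀ᵣ Q)} [Finite B] (hB : IsPGroup p B) (hV : topSubgroup D Q ≤ B)
    (h : Disjoint (B.comap (diagHom D Q)) ⊤) : Disjoint B (baseGroup D Q) := by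
  rw [disjoint_comm, ← Subgroup.subgroupOf_eq_bot]
  by_contra hN
  refine not_disjoint_center_of_isPGroup hB hN (Subgroup.disjoint_def.2 fun {z} hzN hz => ?_)
  have hz_diag : z.1 = diagHom D Q (z.1.left 1) := by
    have := eq_diagHom_mul_inl fun c => congrArg Subtype.val
      (Subgroup.mem_center_iff.1 hz ⟨inl c, hV ⟨c, rfl⟩⟩).symm
    rwa [show z.1.right = 1 from hzN, map_one, mul_one] at this
  have hz1 : z.1.left 1 = 1 := Subgroup.disjoint_def.1 h
    (Subgroup.mem_comap.2 (hz_diag ▸ z.2)) (Subgroup.mem_top _)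
  refine Subtype.ext ?_
  rw [hz_diag, hz1, map_one]
  rfl

end TopSubgroup

section Diagonal

open RegularWreathProduct

variable {p : ℕ} [Fact p.Prime] {Γ : Type u} [Group Γ]

theorem isPGroup_cyclicGroup : IsPGroup p (CyclicGroup p) :=
  IsPGroup.of_card (n := 1) ((Nat.card_zmod p).trans (pow_one p).symm)

theorem isOrbitInduction_diagHom : IsOrbitInduction (diagHom Γ (CyclicGroup p))
    (topSubgroup Γ (CyclicGroup p)) (pSubgroups p Γ) (pSubgroups p (Γ ≀ᵣ CyclicGroup p)) where
  bot_mem := IsPGroup.of_bot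
  map_sup_mem P hP := by
    refine IsPGroup.to_sup_of_normal_right' (hP.map _)
      (isPGroup_cyclicGroup.of_surjective _ (MonoidHom.rangeRestrict_surjective _))
      (le_trans ?_ (Subgroup.centralizer_le_normalizer _))
    rintro _ ⟨d, -, rfl⟩ _ ⟨c, rfl⟩
    exact (commute_diagHom_inl d c).symm
  comap_mem _ hA g _ := (isPGroup_conj_smul hA g).comap_of_injective _ diagHom_injective
  le_conj_smul d := by
    rintro _ ⟨c, rfl⟩
    rw [mem_conj_smul_iff, mul_assoc, ← (commute_diagHom_inl d c).eq, inv_mul_cancel_left]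
    exact ⟨c, rfl⟩

variable {k : Type*} [CommRing k] {M : Type u} [AddCommGroup M] [Module k M]
  (ρ : Representation k Γ M)

theorem wreathRep_diagHom_apply_one (d : Γ) (ξ : CyclicGroup p → M) :
    wreathRep ρ (diagHom Γ (CyclicGroup p) d) ξ 1 = ρ d (ξ 1) := by
  simp [wreathRep_apply, diagHom]

/-- The transformation `ξ ↦ (g ↦ (g ξ)(1))`. -/
noncomputable def toRanDiag (p : ℕ) [Fact p.Prime] :
    invariantsAvoiding (baseGroup Γ (CyclicGroup p)) (wreathRep ρ) (pSubgroups p _) ⟶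
      isOrbitInduction_diagHom.functor.op.ran.obj (invariantsAvoiding ⊤ ρ (pSubgroups p Γ)) :=
  isOrbitInduction_diagHom.toRan (fun _ _ h => IsOrbitInduction.disjoint_of_disjoint_map_sup
      diagHom_injective comap_diagHom_baseGroup.ge h)
    (Pi.evalAddMonoidHom _ 1) (wreathRep_diagHom_apply_one ρ)

variable {A : OrbitFamily (pSubgroups p (Γ ≀ᵣ CyclicGroup p))}

theorem ranPoint_toRanDiag_app {g : Γ ≀ᵣ CyclicGroup p}
    (hg : topSubgroup Γ (CyclicGroup p) ≤ MulAut.conj g • A.sub)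
    (ξ : (invariantsAvoiding (baseGroup Γ (CyclicGroup p)) (wreathRep ρ)
      (pSubgroups p _)).obj (op A)) :
    isOrbitInduction_diagHom.ranPoint g hg ((toRanDiag ρ p).app (op A) ξ) =
      wreathRep ρ g ξ.1 1 :=
  isOrbitInduction_diagHom.ranPoint_toRan_app hg _ _ _ ξ

theorem inclusion_comp_toRanDiag :
    invariantsAvoidingInclusion le_top (wreathRep ρ) _ ≫ toRanDiag ρ p = 0 := by
  have : Nontrivial (CyclicGroup p) := inferInstanceAs (Nontrivial (ZMod p))
  ext A ξ
  refine isOrbitInduction_diagHom.ranPoint_ext fun g hg => ?_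
  have hξ : ξ.1 = 0 := ξ.2.2 fun h => topSubgroup_ne_bot (le_bot_iff.1 (by
    rwa [disjoint_top.1 h, Subgroup.smul_bot] at hg))
  refine (ranPoint_toRanDiag_app ρ hg _).trans (Eq.trans ?_
    (isOrbitInduction_diagHom.ranPoint_zero hg).symm)
  exact congr($(congrArg (wreathRep ρ g) hξ) 1).trans congr($((wreathRep ρ g).map_zero) 1)

theorem wreathRep_eq_zero_of_le_conj_smul {A : Subgroup (Γ ≀ᵣ CyclicGroup p)}
    {g : Γ ≀ᵣ CyclicGroup p} (hg : topSubgroup Γ (CyclicGroup p) ≤ MulAut.conj g • A)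
    {ξ : CyclicGroup p → M} (hξ : ∀ a ∈ A, wreathRep ρ a ξ = ξ)
    (h1 : wreathRep ρ g ξ 1 = 0) : ξ = 0 := by
  have hfix : ∀ c, wreathRep ρ (inl c) (wreathRep ρ g ξ) = wreathRep ρ g ξ := fun c =>
    (apply_mem_invariantsAvoidingSubgroup (K := ⊥) hg
      ⟨hξ, fun h => absurd disjoint_bot_right h⟩).1 _ ⟨c, rfl⟩
  have hgξ : wreathRep ρ g ξ = 0 := funext fun x => by
    rw [← wreathRep_inl_inv_apply_one ρ x (wreathRep ρ g ξ), hfix, h1, Pi.zero_apply]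
  rw [← (wreathRep ρ).inv_self_apply g ξ, hgξ, map_zero]

theorem mem_invariantsAvoidingSubgroup_top_of_toRanDiag_app_eq_zero
    (ξ : (invariantsAvoiding (baseGroup Γ (CyclicGroup p)) (wreathRep ρ)
      (pSubgroups p _)).obj (op A)) (hξ : (toRanDiag ρ p).app (op A) ξ = 0) :
    ξ.1 ∈ invariantsAvoidingSubgroup ⊤ (wreathRep ρ) A.sub := by
  refine ⟨ξ.2.1, fun hA => ?_⟩
  by_cases hd : Disjoint A.sub (baseGroup Γ (CyclicGroup p))
  · have hcard : Nat.card (CyclicGroup p) = p := Nat.card_zmod p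
    have : Fact (Nat.card (CyclicGroup p)).Prime := ⟨hcard.symm ▸ Fact.out⟩
    have hA_map : A.sub.map rightHom = ⊤ :=
      (Subgroup.eq_bot_or_eq_top_of_prime_card _).resolve_left fun h =>
        hA (disjoint_top.2 (hd.eq_bot_of_le ((Subgroup.map_eq_bot_iff _).1 h)))
    obtain ⟨g, hg⟩ := exists_topSubgroup_le_conj_smul hd hA_map
    refine wreathRep_eq_zero_of_le_conj_smul ρ hg ξ.2.1 ?_
    rw [← ranPoint_toRanDiag_app ρ hg ξ, hξ]
    exact isOrbitInduction_diagHom.ranPoint_zero hg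
  · exact ξ.2.2 hd

theorem const_mem_invariantsAvoidingSubgroup_baseGroup (m : M) :
    (fun _ : CyclicGroup p => m) ∈ invariantsAvoidingSubgroup (baseGroup Γ (CyclicGroup p))
      (wreathRep ρ) (topSubgroup Γ (CyclicGroup p)) := by
  refine ⟨?_, fun h => absurd disjoint_topSubgroup_baseGroup h⟩
  rintro _ ⟨c, rfl⟩
  exact funext fun x => wreathRep_inl_apply ρ c _ x

theorem disjoint_baseGroup_of_ranPoint_ne_zero [Finite Γ] {g : Γ ≀ᵣ CyclicGroup p}
    (hg : topSubgroup Γ (CyclicGroup p) ≤ MulAut.conj g • A.sub)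
    {s : (isOrbitInduction_diagHom.functor.op.ran.obj
      (invariantsAvoiding ⊤ ρ (pSubgroups p Γ))).obj (op A)}
    (hs : isOrbitInduction_diagHom.ranPoint g hg s ≠ 0) :
    Disjoint A.sub (baseGroup Γ (CyclicGroup p)) := by
  have : Finite (CyclicGroup p) := inferInstanceAs (Finite (ZMod p))
  by_contra h
  exact hs ((isOrbitInduction_diagHom.ranPoint_mem hg s).2 fun h' => h (disjoint_conj_smul_iff.1
    (disjoint_baseGroup_of_disjoint_comap_diagHom (isPGroup_conj_smul A.property g) hg h')))

theorem exists_eq_diagHom_mul {A : Subgroup (Γ ≀ᵣ CyclicGroup p)} {g g' : Γ ≀ᵣ CyclicGroup p}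
    (hA : Disjoint A (baseGroup Γ (CyclicGroup p)))
    (hg : topSubgroup Γ (CyclicGroup p) ≤ MulAut.conj g • A)
    (hg' : topSubgroup Γ (CyclicGroup p) ≤ MulAut.conj g' • A) :
    ∃ γ c, g' = diagHom Γ (CyclicGroup p) γ * (inl c * g) := by
  have hw : topSubgroup Γ (CyclicGroup p) =
      MulAut.conj (g' * g⁻¹) • topSubgroup Γ (CyclicGroup p) := by
    conv_rhs => rw [topSubgroup_eq_of_le hg (disjoint_conj_smul_iff.2 hA)]
    rw [← mul_smul, ← map_mul, inv_mul_cancel_right]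
    exact topSubgroup_eq_of_le hg' (disjoint_conj_smul_iff.2 hA)
  refine ⟨(g' * g⁻¹).left 1, (g' * g⁻¹).right, ?_⟩
  rw [← mul_assoc, ← eq_diagHom_mul_inl_of_le_conj_smul hw.le, inv_mul_cancel_right]

theorem mk_inl_mul_eq {A : Subgroup (Γ ≀ᵣ CyclicGroup p)} {g : Γ ≀ᵣ CyclicGroup p}
    (hg : topSubgroup Γ (CyclicGroup p) ≤ MulAut.conj g • A) (c : CyclicGroup p) :
    (g : _ ⧸ A) = (inl c * g : Γ ≀ᵣ CyclicGroup p) := by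
  rw [QuotientGroup.eq, ← mul_assoc]
  exact mem_conj_smul_iff.1 (hg ⟨c, rfl⟩)

theorem surjective_toRanDiag_app [Finite Γ] :
    Function.Surjective ((toRanDiag ρ p).app (op A)) := by
  intro s
  let hj := isOrbitInduction_diagHom (p := p) (Γ := Γ)
  by_cases hs : ∀ g hg, hj.ranPoint g hg s = 0
  · exact ⟨0, (map_zero _).trans (hj.ranPoint_ext fun g hg =>
      (hj.ranPoint_zero hg).trans (hs g hg).symm)⟩
  push Not at hs
  obtain ⟨g₀, hg₀, hs₀⟩ := hs
  have hA : Disjoint A.sub (baseGroup Γ (CyclicGroup p)) :=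
    disjoint_baseGroup_of_ranPoint_ne_zero ρ hg₀ hs₀
  let ζ : CyclicGroup p → M := fun _ => hj.ranPoint g₀ hg₀ s
  have hζ : wreathRep ρ g₀⁻¹ ζ ∈
      invariantsAvoidingSubgroup (baseGroup Γ (CyclicGroup p)) (wreathRep ρ) A.sub := by
    refine apply_mem_invariantsAvoidingSubgroup ?_
      (const_mem_invariantsAvoidingSubgroup_baseGroup ρ _)
    rw [topSubgroup_eq_of_le hg₀ (disjoint_conj_smul_iff.2 hA), ← mul_smul, ← map_mul,
      inv_mul_cancel, map_one, one_smul]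
  refine ⟨⟨_, hζ⟩, hj.ranPoint_ext fun g hg => (ranPoint_toRanDiag_app ρ hg _).trans ?_⟩
  obtain ⟨γ, c, rfl⟩ := exists_eq_diagHom_mul hA hg₀ hg
  have hc := mk_inl_mul_eq hg₀ c
  have hg₀' : topSubgroup Γ (CyclicGroup p) ≤ MulAut.conj (inl c * g₀) • A.sub :=
    conj_smul_eq_of_mk_eq hc ▸ hg₀
  calc wreathRep ρ (diagHom Γ (CyclicGroup p) γ * (inl c * g₀)) (wreathRep ρ g₀⁻¹ ζ) 1
      = ρ γ (hj.ranPoint g₀ hg₀ s) := by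
        rw [map_mul, map_mul, Module.End.mul_apply, wreathRep_diagHom_apply_one,
          Module.End.mul_apply, (wreathRep ρ).self_inv_apply, wreathRep_inl_apply]
    _ = hj.ranPoint _ hg s := by
        rw [hj.ranPoint_eq_of_mk_eq hg₀ s hg₀' hc, hj.ranPoint_map_mul hg₀' s hg]

theorem higherLimit_invariantsAvoiding_wreath_iso [Finite Γ] (hp : p ∣ Nat.card Γ)
    [Module (ZMod p) M] (ρ : Representation (ZMod p) Γ M) (i : ℕ) :
    Nonempty (higherLimit (i + 1)
        (invariantsAvoiding ⊤ (wreathRep (p := p) ρ) (pSubgroups p _)) ≅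
      higherLimit i (invariantsAvoiding ⊤ ρ (pSubgroups p Γ))) := by
  have hS : (ShortComplex.mk _ _ (inclusion_comp_toRanDiag (p := p) ρ)).ShortExact :=
    shortExact_of_app
      (fun _ => AddSubgroup.inclusion_injective (invariantsAvoidingSubgroup_mono le_top))
      (fun _ => surjective_toRanDiag_app ρ)
      fun _ ξ hξ => ⟨⟨ξ.1, mem_invariantsAvoidingSubgroup_top_of_toRanDiag_app_eq_zero ρ ξ hξ⟩,
        rfl⟩
  obtain ⟨e⟩ := higherLimit_succ_iso_of_shortExact hS
    (isZero_higherLimit_invariantsAvoiding_baseGroup hp ρ) i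
  obtain ⟨e'⟩ := isOrbitInduction_diagHom.isMultiLeftAdjoint_functor.higherLimit_ran_iso i
    (invariantsAvoiding ⊤ ρ (pSubgroups p Γ))
  exact ⟨e ≪≫ e'⟩

end Diagonal

section Sylow

variable {p : ℕ} {G : Type u} [Group G]

theorem mem_invariantsAvoidingSubgroup_top_iff {k : Type*} [CommRing k] {M : Type u}
    [AddCommGroup M] [Module k M] {ρ : Representation k G M} {P : Subgroup G} {m : M} :
    m ∈ invariantsAvoidingSubgroup ⊤ ρ P ↔ m ∈ atomicSubgroup M P := by
  rw [mem_invariantsAvoidingSubgroup, mem_atomicSubgroup, disjoint_top]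
  refine and_iff_right_of_imp fun h a ha => ?_
  obtain rfl | hP := eq_or_ne P ⊥
  · rw [Subgroup.mem_bot.1 ha, map_one, Module.End.one_apply]
  · rw [h hP, map_zero]

/-- The inclusion of the orbit category on the subgroups of a Sylow subgroup into the orbit
category on all `p`-subgroups. -/
def sylowInclusion (T : Sylow p G) :
    OrbitCat (T : Subgroup G) ⥤ OrbitFamily (pSubgroups p G) where
  obj P := .mk P.toSubgroup (T.isPGroup'.to_le P.le)
  map φ := ObjectProperty.homMk φ

instance (T : Sylow p G) : (sylowInclusion T).Full := ⟨fun φ => ⟨φ.hom, rfl⟩⟩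

instance (T : Sylow p G) : (sylowInclusion T).Faithful :=
  ⟨fun h => congrArg InducedCategory.Hom.hom h⟩

instance [Fact p.Prime] [Finite (Sylow p G)] (T : Sylow p G) : (sylowInclusion T).EssSurj where
  mem_essImage P := by
    obtain ⟨T', hT'⟩ := IsPGroup.exists_le_sylow P.property
    obtain ⟨g, rfl⟩ := MulAction.exists_smul_eq G T' T
    let Q : OrbitCat (G := G) (g • T' : Sylow p G) := ⟨MulAut.conj g • P.sub,
      Subgroup.pointwise_smul_le_pointwise_smul_iff.2 hT'⟩
    exact ⟨Q, ⟨OrbitFamily.isoOfConjEq g rfl⟩⟩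

theorem lambda_iso_higherLimit [Fact p.Prime] [Finite (Sylow p G)] (T : Sylow p G) {k : Type*}
    [CommRing k] {M : Type u} [AddCommGroup M] [Module k M] (ρ : Representation k G M) (i : ℕ) :
    Nonempty (Lambda T i ρ ≅ higherLimit i (invariantsAvoiding ⊤ ρ (pSubgroups p G))) := by
  have : (sylowInclusion T).IsEquivalence := {}
  let e : (sylowInclusion T).op ⋙ invariantsAvoiding ⊤ ρ (pSubgroups p G) ≅
      atomicFunctor (T : Subgroup G) ρ :=
    NatIso.ofComponents (fun P => (AddEquiv.addSubgroupCongr (AddSubgroup.ext fun _ =>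
      mem_invariantsAvoidingSubgroup_top_iff)).toAddCommGrpIso) fun _ => rfl
  let adj := (sylowInclusion T).asEquivalence.symm.toAdjunction
  obtain ⟨e'⟩ := higherLimit_comp_iso_of_adjunction adj i
    (invariantsAvoiding ⊤ ρ (pSubgroups p G))
  exact ⟨higherLimitIso i e.symm ≪≫ e'⟩

end Sylow

theorem lemma2p5 {p : ℕ} [Fact p.Prime] {Γ : Type u} [Group Γ] [Finite Γ]
    (hp : p ∣ Nat.card Γ)
    {M : Type u} [AddCommGroup M] [Module (ZMod p) M] (ρ : Representation (ZMod p) Γ M)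
    (T : Sylow p Γ) (S : Sylow p (Γ ≀ᵣ CyclicGroup p)) (i : ℕ) (hi : 1 ≤ i) :
    Nonempty (Lambda S i (wreathRep (p := p) ρ) ≅ Lambda T (i - 1) ρ) := by
  have : Finite (CyclicGroup p) := inferInstanceAs (Finite (ZMod p))
  obtain ⟨i, rfl⟩ := Nat.exists_eq_add_of_le' hi
  obtain ⟨e₁⟩ := lambda_iso_higherLimit S (wreathRep (p := p) ρ) (i + 1)
  obtain ⟨e₂⟩ := higherLimit_invariantsAvoiding_wreath_iso hp ρ i
  obtain ⟨e₃⟩ := lambda_iso_higherLimit T ρ i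
  exact ⟨e₁ ≪≫ e₂ ≪≫ e₃.symm⟩
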